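/- **Theorem (Distributional convergence of Q-learning).** Let $(\mathcal S,\mathcal A,P,r,\gamma)$ be a discounted Markov decision process with nonempty finite state space $\mathcal S$ and action space $\mathcal A$, transition kernel $P(\cdot\mid s,a)$, random reward vector $r\in\mathbb R^{\mathcal S\times\mathcal A}$ with mean $\bar r=\mathbb E[r]$, and discount factor $\gamma\in(0,1)$. Let $q^*(s,a)=\sup_\pi q^\pi(s,a)$ be the optimal Q-function, where $q^\pi(s,a)=\mathbb E_\pi\big[\sum_{k\ge0}\gamma^k r_k(s_k,a_k)\mid s_0=s,a_0=a\big]$, $s_{k+1}\sim P(\cdot\mid s_k,a_k)$, $a_{k+1}\sim\pi(\cdot\mid s_{k+1})$, and the $r_k$ are copies of $r$ independent of the trajectory. For $q\in\mathbb R^{\mathcal S\times\mathcal A}$ let $f_s(q)=\max_{a}q(s,a)$. For a stepsize $\alpha>0$ consider $$q^{(\alpha)}_{t+1}=q^{(\alpha)}_t+\alpha D_t\big(\gamma P_tf(q^{(\alpha)}_t)-q^{(\alpha)}_t+r_t\big),\qquad t\ge0,$$ where $(D_t,P_t,r_t)_{t\ge0}$ are i.i.d. and independent of $q_0^{(\alpha)}$,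 $D_t$ is a random $|\mathcal S||\mathcal A|\times|\mathcal S||\mathcal A|$ matrix, $P_t$ a random $|\mathcal S||\mathcal A|\times|\mathcal S|$ matrix, $r_t$ has the law of $r$, and $\mathbb E[D_0]=D$ is diagonal with $D_{ii}\in(0,1]$, $\mathbb E[P_0]=P$, $\mathbb E[D_0P_0]=DP$, $\mathbb E[D_0r_0]=D\bar r$. Assume that $D_0,P_0,r_0$ and the products $D_0P_0$, $D_0r_0$ have finite second moments (the conditions on the products hold automatically if, for instance, $D_0$ is independent of $(P_0,r_0)$ and the three factors have finite second moments). Put $\gamma_0=1-(1-\gamma)\min_iD_{ii}\in(0,1)$, and let $W_2$ be the Wasserstein 2-distance on $\mathbb R^{\mathcal S\times\mathcal A}$ for the norm $\|\cdot\|_\infty$. Then there is $\bar\alpha\in(0,1]$, depending only on the decision process and the law of $(D_0,P_0,r_0)$, such that: 1. For every $\alpha\in(0,\bar\alpha]$ the Markov chain $(q^{(\alpha)}_t)_{t\ge0}$ has exactly one stationary probability distribution; let $q^{(\alpha)}$ be a random vector with this law. 2. For every $R\ge0$ there is a constant $c$, independent of $\alpha$ and $t$, such that for all $\alpha\in(0,\bar\alpha]$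 and every initial vector $q_0^{(\alpha)}$ with $\mathbb E\|q_0^{(\alpha)}\|_\infty^2\le R$, $$W_2^2\big(\mathcal L(q_t^{(\alpha)}),\mathcal L(q^{(\alpha)})\big)\le c\,\big(1-\alpha(1-\sqrt{\gamma_0})\big)^t\qquad\text{for all }t\ge0 .$$ 3. There is a constant $C$ such that $\mathbb E\|q^{(\alpha)}-q^*\|_2^2\le C\alpha$ for all $\alpha\in(0,\bar\alpha]$. -/

import Mathlib

open MeasureTheory ProbabilityTheory Set
open scoped ENNReal NNReal

noncomputable section

namespace QLearning

/-- A discounted Markov decision process with finite state space `S` and finite action space `A`: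
transition kernel `P(· | s, a)`, law of the random reward vector `(r(s, a))_{s, a}`,
and discount factor in `(0, 1)`. -/
structure MDP (S A : Type*) [Fintype S] [Fintype A] where
  trans : S × A → stdSimplex ℝ S
  rewardLaw : Measure (S × A → ℝ)
  isProbabilityMeasure_rewardLaw : IsProbabilityMeasure rewardLaw
  discount : ℝ
  discount_pos : 0 < discount
  discount_lt_one : discount < 1

/-- Values of one observation `(D_t, P_t, r_t)`: a square matrix indexed by `S × A`, a matrix with
rows indexed by `S × A` and columns by `S`, and a vector indexed by `S × A`. -/
abbrev Noise (S A : Type*) : Type _ :=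
  (S × A → S × A → ℝ) × (S × A → S → ℝ) × (S × A → ℝ)

variable {S A : Type*} [Fintype S] [Fintype A]

/-- The expected reward `r̄(s, a)`. -/
def MDP.meanReward (M : MDP S A) (x : S × A) : ℝ := ∫ r, r x ∂M.rewardLaw

/-- The probability of `(s_k, a_k) = y` when `(s_0, a_0) = x`, `s_{k+1} ∼ P(· | s_k, a_k)` and
`a_{k+1} ∼ π(· | s_{k+1})`. -/
def MDP.stepProb [DecidableEq S] [DecidableEq A] (M : MDP S A) (π : S → stdSimplex ℝ A)
    (x : S × A) : ℕ → S × A → ℝ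
  | 0, y => if y = x then 1 else 0
  | k + 1, y => ∑ z, M.stepProb π x k z * (M.trans z y.1 * π y.1 y.2)

/-- The Q-function of a policy:
`q^π(s, a) = E_π[∑_k γ^k r_k(s_k, a_k) | s_0 = s, a_0 = a]`, where the reward vectors `r_k` are
copies of `r` independent of the state-action trajectory. -/
def MDP.qPolicy [DecidableEq S] [DecidableEq A] (M : MDP S A) (π : S → stdSimplex ℝ A)
    (x : S × A) : ℝ :=
  ∑' k : ℕ, M.discount ^ k * ∑ y, M.stepProb π x k y * M.meanReward y

/-- The optimal Q-function: the supremum of `q^π` over all policies. -/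
def MDP.qStar [DecidableEq S] [DecidableEq A] (M : MDP S A) (x : S × A) : ℝ :=
  ⨆ π : S → stdSimplex ℝ A, M.qPolicy π x

/-- `f_s(q) = max_a q(s, a)`. -/
def maxQ [Nonempty A] (q : S × A → ℝ) (s : S) : ℝ :=
  Finset.univ.sup' Finset.univ_nonempty fun a => q (s, a)

/-- One step of the recursion: `q + α D (γ P f(q) - q + r)` with `ξ = (D, P, r)`. -/
def qUpdate [Nonempty A] (γ α : ℝ) (ξ : Noise S A) (q : S × A → ℝ) : S × A → ℝ :=
  fun i => q i + α * ∑ j, ξ.1 i j * (γ * (∑ s, ξ.2.1 j s * maxQ q s) - q j + ξ.2.2 j)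

/-- The diagonal entry `D_ii` of `D = E[D_0]` when `(D_0, P_0, r_0)` has law `law`. -/
def meanD (law : Measure (Noise S A)) (i : S × A) : ℝ := ∫ ξ, ξ.1 i i ∂law

/-- `law` is an admissible law of `(D_0, P_0, r_0)` for the decision process `M`:
`E[D_0] = D` is diagonal with diagonal entries in `(0, 1]`, `E[P_0] = P`, `r_0` is a copy of `r`,
and `E[D_0 P_0] = D P`, `E[D_0 r_0] = D r̄`, so that the expected update direction at `q` is
`D (γ P f(q) - q + r̄)`. -/
structure IsAdmissible (M : MDP S A) (law : Measure (Noise S A)) : Prop where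
  isProbabilityMeasure : IsProbabilityMeasure law
  meanD_mem : ∀ i, meanD law i ∈ Ioc (0 : ℝ) 1
  meanD_offDiag : ∀ i j, i ≠ j → ∫ ξ, ξ.1 i j ∂law = 0
  mean_P : ∀ i s, ∫ ξ, ξ.2.1 i s ∂law = M.trans i s
  law_reward : law.map (fun ξ => ξ.2.2) = M.rewardLaw
  mean_DP : ∀ i s, ∫ ξ, ∑ j, ξ.1 i j * ξ.2.1 j s ∂law = meanD law i * M.trans i s
  mean_Dr : ∀ i, ∫ ξ, ∑ j, ξ.1 i j * ξ.2.2 j ∂law = meanD law i * M.meanReward i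

/-- The random matrices and vectors `D_0`, `P_0`, `r_0`, and the products `D_0 P_0`, `D_0 r_0` that
enter the recursion, have finite `p`-th moments. -/
structure HasFiniteMoments (p : ℝ≥0∞) (law : Measure (Noise S A)) : Prop where
  moment_D : ∀ i j, MemLp (fun ξ : Noise S A => ξ.1 i j) p law
  moment_P : ∀ i s, MemLp (fun ξ : Noise S A => ξ.2.1 i s) p law
  moment_r : ∀ i, MemLp (fun ξ : Noise S A => ξ.2.2 i) p law
  moment_DP : ∀ i s, MemLp (fun ξ : Noise S A => ∑ j, ξ.1 i j * ξ.2.1 j s) p law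
  moment_Dr : ∀ i, MemLp (fun ξ : Noise S A => ∑ j, ξ.1 i j * ξ.2.2 j) p law

/-- The contraction factor `γ₀ = 1 - (1 - γ) min_i D_ii`. -/
def gammaZero [Nonempty S] [Nonempty A] (M : MDP S A) (law : Measure (Noise S A)) : ℝ :=
  1 - (1 - M.discount) * Finset.univ.inf' Finset.univ_nonempty (meanD law)

/-- `q` is a Q-learning trajectory with stepsize `α`: the observations `ξ t = (D_t, P_t, r_t)` are
i.i.d. with law `law`, the initial value `q 0` is independent of them, and `q (t + 1)` is obtained
from `q t` and `ξ t` by the recursion. -/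
structure IsTrajectory [Nonempty A] (γ α : ℝ) (law : Measure (Noise S A))
    {Ω : Type*} [MeasurableSpace Ω] (Pr : Measure Ω)
    (ξ : ℕ → Ω → Noise S A) (q : ℕ → Ω → S × A → ℝ) : Prop where
  measurable_noise : ∀ t, Measurable (ξ t)
  law_noise : ∀ t, Pr.map (ξ t) = law
  indep_noise : iIndepFun ξ Pr
  measurable_init : Measurable (q 0)
  indep_init : IndepFun (q 0) (fun ω t => ξ t ω) Pr
  step : ∀ t ω, q (t + 1) ω = qUpdate γ α (ξ t ω) (q t ω)

/-- `μ` is a stationary distribution of the Markov chain with stepsize `α`: if `q` has law `μ` and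
`ξ` is independent of `q` with law `law`, then the updated vector again has law `μ`. -/
def IsStationary [Nonempty A] (γ α : ℝ) (law : Measure (Noise S A))
    (μ : Measure (S × A → ℝ)) : Prop :=
  (μ.prod law).map (fun z => qUpdate γ α z.2 z.1) = μ

/-- The Wasserstein 2-distance for the norm of `E`, as an infimum over couplings. For
`E = (S × A → ℝ)` the norm is the sup norm. -/
def W2 {E : Type*} [NormedAddCommGroup E] [MeasurableSpace E] (μ ν : Measure E) : ℝ≥0∞ :=
  ⨅ π ∈ {π : Measure (E × E) | π.map Prod.fst = μ ∧ π.map Prod.snd = ν},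
    (∫⁻ z, ‖z.1 - z.2‖ₑ ^ 2 ∂π) ^ (1 / 2 : ℝ)

end QLearning

end

/-!
The recursion is a random iteration `q ↦ F ξ q` with i.i.d. `ξ`. Its mean, with stepsize one,
contracts the sup norm by `γ₀` (`abs_mean_update_sub_le`). The squared sup norm is not smooth, so
with it the noise would enter at order `α` and destroy the contraction. It is replaced by its Moreau
envelope `supEnvelope`, the infimal convolution with a multiple of the squared Euclidean norm. This
is still comparable with the squared sup norm, with constants `γ₀` and `1`, while mean-zero noise
now changes its expectation by a term of order `α ^ 2` only (`lintegral_supEnvelope_le`). Hence one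
step contracts the envelope by `1 - α (1 - γ₀) + O(α ^ 2)`, and the gap between `γ₀` and `√γ₀`
absorbs the last term for small `α` (`contractsOnAverage_qUpdate`).

Everything else follows from this contraction on average. Backward iterates
`F (ω 0) (F (ω 1) (… x))` converge almost surely, and the law of their limit is stationary. Started
from the random point of any other stationary law, backward iterates merge with the convergent ones,
which gives uniqueness without moment assumptions (`ContractsOnAverage.exists_stationary`). Driving
two copies of the chain by the same observations gives the geometric bound on `W2`
(`ContractsOnAverage.W2_iterate_le`).

For the second moment, the Bellman equation `MDP.bellman_qStar` says that the mean update direction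
vanishes at `q*`. The same one-step estimate then yields the drift inequality
`E V(F ξ q - q*) ≤ (1 - α (1 - √γ₀)) V(q - q*) + O(α ^ 2)` for the envelope `V`. Iterating it from
`q*` bounds the second moment of the limit by `O(α)`, uniformly in `α`; this also makes the constant
in the `W2` bound independent of `α`.
-/

noncomputable section

namespace QLearning

open Filter Topology

/-! ### Sequences of i.i.d. observations -/

section Sequences

variable {N : Type*} [MeasurableSpace N]

/-- The sequence `x, ω 0, ω 1, …`. -/
def consSeq (x : N) (ω : ℕ → N) : ℕ → N
  | 0 => x
  | n + 1 => ω n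

theorem measurable_consSeq : Measurable fun p : N × (ℕ → N) => consSeq p.1 p.2 := by
  refine measurable_pi_lambda _ fun n => ?_
  cases n with
  | zero => exact measurable_fst
  | succ n => exact (measurable_pi_apply n).comp measurable_snd

/-- An i.i.d. sequence is an independent pair of its first term and the rest, and the rest has the
law of the whole sequence. -/
theorem measurePreserving_consSeq (law : Measure N) [IsProbabilityMeasure law] :
    MeasurePreserving (fun p : N × (ℕ → N) => consSeq p.1 p.2)
      (law.prod (Measure.infinitePi fun _ => law)) (Measure.infinitePi fun _ => law) := by
  refine ⟨measurable_consSeq, Measure.eq_infinitePi _ fun s t ht => ?_⟩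
  classical
  obtain ⟨n, hn⟩ := s.exists_nat_subset_range
  -- Sets not constrained by `s` are replaced by `univ`, so that an initial segment can be used.
  set t' : ℕ → Set N := fun i => if i ∈ s then t i else univ with ht'
  have ht'm : ∀ i, MeasurableSet (t' i) := fun i => by
    by_cases h : i ∈ s
    · simpa [ht', h] using ht i
    · simp [ht', h]
  have hprod : ∏ i ∈ s, law (t i) = ∏ i ∈ Finset.range (n + 1), law (t' i) := by
    rw [← Finset.prod_subset (hn.trans (Finset.range_subset_range.2 n.le_succ))]
    · exact Finset.prod_congr rfl fun i hi => by simp [ht', hi]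
    · intro i _ hi
      simp [ht', hi]
  have hpre : (fun p : N × (ℕ → N) => consSeq p.1 p.2) ⁻¹' ((s : Set ℕ).pi t)
      = t' 0 ×ˢ ((Finset.range n : Set ℕ).pi fun i => t' (i + 1)) := by
    ext ⟨x, ω⟩
    simp only [mem_preimage, Set.mem_pi, mem_prod, Finset.mem_coe, Finset.mem_range, ht']
    constructor
    · intro h
      refine ⟨?_, fun i _ => ?_⟩
      · by_cases h0 : 0 ∈ s
        · simpa [h0, consSeq] using h 0 h0
        · simp [h0]
      · by_cases h0 : i + 1 ∈ s
        · simpa [h0, consSeq] using h (i + 1) h0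
        · simp [h0]
    · rintro ⟨h0, h1⟩ i hi
      cases i with
      | zero => simpa [hi, consSeq] using h0
      | succ i =>
        have := h1 i (by have := Finset.mem_range.1 (hn hi); omega)
        simpa [hi, consSeq] using this
  rw [Measure.map_apply measurable_consSeq
    (MeasurableSet.pi s.countable_toSet fun i _ => ht i), hpre, Measure.prod_prod,
    Measure.infinitePi_pi _ fun i _ => ht'm (i + 1), hprod, Finset.prod_range_succ', mul_comm]

theorem lintegral_infinitePi_consSeq (law : Measure N) [IsProbabilityMeasure law]
    {g : (ℕ → N) → ℝ≥0∞} (hg : Measurable g) :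
    ∫⁻ ω, g ω ∂(Measure.infinitePi fun _ => law)
      = ∫⁻ ω, ∫⁻ x, g (consSeq x ω) ∂law ∂(Measure.infinitePi fun _ => law) := by
  rw [← (measurePreserving_consSeq law).map_eq, lintegral_map hg measurable_consSeq,
    (measurePreserving_consSeq law).map_eq,
    lintegral_prod_symm _ (by exact (hg.comp measurable_consSeq).aemeasurable)]

end Sequences

/-! ### Iterated random maps -/

section RandomMaps

variable {N : Type*} [MeasurableSpace N] {E : Type*} [MeasurableSpace E]

/-- One step of the Markov chain `x ↦ F ξ x` with `ξ ∼ law`, acting on laws. -/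
def chainStep (F : N → E → E) (law : Measure N) (ν : Measure E) : Measure E :=
  (ν.prod law).map fun z => F z.2 z.1

/-- The forward iteration `F (ω (n - 1)) (… (F (ω 0) z))`. -/
def forwardIter (F : N → E → E) : ℕ → (ℕ → N) → E → E
  | 0, _, z => z
  | n + 1, ω, z => forwardIter F n (fun k => ω (k + 1)) (F (ω 0) z)

/-- The backward iteration `F (ω 0) (… (F (ω (n - 1)) z))`. It has the law of the forward iteration
for each `n`, but unlike the latter it converges as `n → ∞`. -/
def backwardIter (F : N → E → E) : ℕ → (ℕ → N) → E → E
  | 0, _, z => z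
  | n + 1, ω, z => F (ω 0) (backwardIter F n (fun k => ω (k + 1)) z)

variable {F : N → E → E}

theorem measurable_forwardIter (hF : Measurable (Function.uncurry F)) (n : ℕ) :
    Measurable fun p : (ℕ → N) × E => forwardIter F n p.1 p.2 := by
  induction n with
  | zero => exact measurable_snd
  | succ n ih =>
    have h0 : Measurable fun p : (ℕ → N) × E => F (p.1 0) p.2 :=
      hF.comp (g := Function.uncurry F) (f := fun p : (ℕ → N) × E => (p.1 0, p.2)) (by fun_prop)
    have h1 : Measurable fun p : (ℕ → N) × E => ((fun k => p.1 (k + 1) : ℕ → N), F (p.1 0) p.2) :=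
      .prodMk (by fun_prop) h0
    exact ih.comp h1

theorem measurable_backwardIter (hF : Measurable (Function.uncurry F)) (n : ℕ) :
    Measurable fun p : (ℕ → N) × E => backwardIter F n p.1 p.2 := by
  induction n with
  | zero => exact measurable_snd
  | succ n ih =>
    have h0 : Measurable fun p : (ℕ → N) × E => ((fun k => p.1 (k + 1) : ℕ → N), p.2) := by
      fun_prop
    have h1 : Measurable fun p : (ℕ → N) × E => p.1 0 := by fun_prop
    exact hF.comp (h1.prodMk (ih.comp h0))

theorem chainStep_isProbabilityMeasure (hF : Measurable (Function.uncurry F)) (law : Measure N)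
    [IsProbabilityMeasure law] (ν : Measure E) [IsProbabilityMeasure ν] :
    IsProbabilityMeasure (chainStep F law ν) :=
  Measure.isProbabilityMeasure_map (hF.comp measurable_swap).aemeasurable

/-- The forward iteration started from the law `ν` has the `n`-step law of the Markov chain. -/
theorem map_forwardIter (hF : Measurable (Function.uncurry F)) (law : Measure N)
    [IsProbabilityMeasure law] (n : ℕ) (ν : Measure E) [IsProbabilityMeasure ν] :
    (ν.prod (Measure.infinitePi fun _ => law)).map (fun p => forwardIter F n p.2 p.1)
      = (chainStep F law)^[n] ν := by
  induction n generalizing ν with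
  | zero => simp [forwardIter, Measure.map_fst_prod]
  | succ n ih =>
    have := chainStep_isProbabilityMeasure hF law ν
    rw [Function.iterate_succ_apply, ← ih]
    have hm : Measurable fun p : E × (ℕ → N) => forwardIter F n p.2 p.1 :=
      (measurable_forwardIter hF n).comp measurable_swap
    have hm' : Measurable fun p : E × (ℕ → N) => forwardIter F (n + 1) p.2 p.1 :=
      (measurable_forwardIter hF (n + 1)).comp measurable_swap
    have hFs : Measurable fun z : E × N => F z.2 z.1 := hF.comp measurable_swap
    set P : Measure (ℕ → N) := Measure.infinitePi fun _ => law with hP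
    have h1 : ν.prod P = (ν.prod (law.prod P)).map (Prod.map id fun p => consSeq p.1 p.2) := by
      have h := Measure.map_prod_map ν (law.prod P) measurable_id measurable_consSeq
      rw [(measurePreserving_consSeq law).map_eq, Measure.map_id] at h
      exact h
    have h2 : (chainStep F law ν).prod P
        = ((ν.prod law).prod P).map (Prod.map (fun z : E × N => F z.2 z.1) id) := by
      have h := Measure.map_prod_map (ν.prod law) P hFs measurable_id
      rw [Measure.map_id] at h
      exact h
    rw [h1, h2, Measure.map_map hm' (measurable_id.prodMap measurable_consSeq),
      Measure.map_map hm (hFs.prodMap measurable_id), ← Measure.prodAssoc_prod,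
      Measure.map_map (hm'.comp (measurable_id.prodMap measurable_consSeq))
        MeasurableEquiv.prodAssoc.measurable]
    rfl

/-- The backward iteration started from the law `ν` has the `n`-step law of the Markov chain. -/
theorem map_backwardIter (hF : Measurable (Function.uncurry F)) (law : Measure N)
    [IsProbabilityMeasure law] (n : ℕ) (ν : Measure E) [IsProbabilityMeasure ν] :
    (ν.prod (Measure.infinitePi fun _ => law)).map (fun p => backwardIter F n p.2 p.1)
      = (chainStep F law)^[n] ν := by
  induction n with
  | zero => simp [backwardIter, Measure.map_fst_prod]
  | succ n ih =>
    rw [Function.iterate_succ_apply', ← ih]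
    have hm : Measurable fun p : E × (ℕ → N) => backwardIter F n p.2 p.1 :=
      (measurable_backwardIter hF n).comp measurable_swap
    have hm' : Measurable fun p : E × (ℕ → N) => backwardIter F (n + 1) p.2 p.1 :=
      (measurable_backwardIter hF (n + 1)).comp measurable_swap
    have hFs : Measurable fun z : E × N => F z.2 z.1 := hF.comp measurable_swap
    set P : Measure (ℕ → N) := Measure.infinitePi fun _ => law with hP
    have h1 : ν.prod P = (ν.prod (P.prod law)).map
        (Prod.map id fun p => consSeq p.2 p.1) := by
      have hc : Measurable fun p : (ℕ → N) × N => consSeq p.2 p.1 :=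
        measurable_consSeq.comp measurable_swap
      have h := Measure.map_prod_map ν (P.prod law) measurable_id hc
      have h' : (P.prod law).map (fun p => consSeq p.2 p.1) = P := by
        rw [← Measure.prod_swap, Measure.map_map hc measurable_swap]
        exact (measurePreserving_consSeq law).map_eq
      rw [h', Measure.map_id] at h
      exact h
    have h2 : ((ν.prod P).map fun p => backwardIter F n p.2 p.1).prod law
        = ((ν.prod P).prod law).map
          (Prod.map (fun p : E × (ℕ → N) => backwardIter F n p.2 p.1) id) := by
      have h := Measure.map_prod_map (ν.prod P) law hm measurable_id
      rw [Measure.map_id] at h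
      exact h
    have hc : Measurable fun p : (ℕ → N) × N => consSeq p.2 p.1 :=
      measurable_consSeq.comp measurable_swap
    rw [chainStep, h2, Measure.map_map hFs (hm.prodMap measurable_id)]
    conv_lhs => rw [h1]
    rw [Measure.map_map hm' (measurable_id.prodMap hc), ← Measure.prodAssoc_prod,
      Measure.map_map (hm'.comp (measurable_id.prodMap hc)) MeasurableEquiv.prodAssoc.measurable]
    rfl

end RandomMaps

/-! ### Random maps that contract on average -/

section Contraction

variable {N : Type*} [MeasurableSpace N] {E : Type*} [NormedAddCommGroup E] [MeasurableSpace E]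

/-- The random maps `F ξ`, `ξ ∼ law`, contract on average by the factor `ρ < 1` when the
displacement of two points is measured by `V`, a function comparable with the squared norm. -/
structure ContractsOnAverage (F : N → E → E) (law : Measure N) (V : E → ℝ≥0∞) (c ρ : ℝ≥0∞) :
    Prop where
  measurable_map : Measurable (Function.uncurry F)
  continuous_map : ∀ ξ, Continuous (F ξ)
  measurable_gauge : Measurable V
  ne_zero : c ≠ 0
  ne_top : c ≠ ∞
  lt_one : ρ < 1
  lower : ∀ x, c * ‖x‖ₑ ^ 2 ≤ V x
  upper : ∀ x, V x ≤ ‖x‖ₑ ^ 2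
  contract : ∀ x y, ∫⁻ ξ, V (F ξ x - F ξ y) ∂law ≤ ρ * V (x - y)

variable {F : N → E → E} {law : Measure N} {V : E → ℝ≥0∞} {c ρ : ℝ≥0∞}

namespace ContractsOnAverage

theorem measurable_backwardIter_apply (h : ContractsOnAverage F law V c ρ) (n : ℕ) (x : E) :
    Measurable fun ω => backwardIter F n ω x :=
  (measurable_backwardIter h.measurable_map n).comp (measurable_id.prodMk measurable_const)

theorem enorm_sq_le (h : ContractsOnAverage F law V c ρ) (x : E) : ‖x‖ₑ ^ 2 ≤ c⁻¹ * V x :=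
  (ENNReal.mul_le_iff_le_inv h.ne_zero h.ne_top).1 (h.lower x)

theorem gauge_ne_top (h : ContractsOnAverage F law V c ρ) (x : E) : V x ≠ ∞ :=
  ((h.upper x).trans_lt (ENNReal.pow_lt_top enorm_lt_top)).ne

variable [BorelSpace E] [SecondCountableTopology E]

theorem measurable_gauge_backwardIter_sub (h : ContractsOnAverage F law V c ρ) (m n : ℕ)
    (x y : E) : Measurable fun ω => V (backwardIter F m ω x - backwardIter F n ω y) :=
  h.measurable_gauge.comp
    ((h.measurable_backwardIter_apply m x).sub (h.measurable_backwardIter_apply n y))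

variable [IsProbabilityMeasure law]

theorem lintegral_backwardIter_sub (h : ContractsOnAverage F law V c ρ) (n : ℕ) (x y : E) :
    ∫⁻ ω, V (backwardIter F n ω x - backwardIter F n ω y) ∂(Measure.infinitePi fun _ => law)
      ≤ ρ ^ n * V (x - y) := by
  induction n with
  | zero => simp [backwardIter]
  | succ n ih =>
    rw [lintegral_infinitePi_consSeq law (h.measurable_gauge_backwardIter_sub _ _ x y)]
    calc _ ≤ ∫⁻ ω, ρ * V (backwardIter F n ω x - backwardIter F n ω y)
          ∂(Measure.infinitePi fun _ => law) := lintegral_mono fun ω => h.contract _ _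
      _ ≤ ρ * (ρ ^ n * V (x - y)) := by
        rw [lintegral_const_mul' _ _ h.lt_one.ne_top]
        gcongr
      _ = ρ ^ (n + 1) * V (x - y) := by ring

theorem lintegral_backwardIter_succ_sub (h : ContractsOnAverage F law V c ρ) (n : ℕ) (x : E) :
    ∫⁻ ω, V (backwardIter F (n + 1) ω x - backwardIter F n ω x)
      ∂(Measure.infinitePi fun _ => law) ≤ ρ ^ n * ∫⁻ ξ, V (F ξ x - x) ∂law := by
  induction n with
  | zero =>
    rw [lintegral_infinitePi_consSeq law (h.measurable_gauge_backwardIter_sub _ _ x x)]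
    simp [backwardIter, consSeq]
  | succ n ih =>
    rw [lintegral_infinitePi_consSeq law (h.measurable_gauge_backwardIter_sub _ _ x x)]
    calc _ ≤ ∫⁻ ω, ρ * V (backwardIter F (n + 1) ω x - backwardIter F n ω x)
          ∂(Measure.infinitePi fun _ => law) := lintegral_mono fun ω => h.contract _ _
      _ ≤ ρ * (ρ ^ n * ∫⁻ ξ, V (F ξ x - x) ∂law) := by
        rw [lintegral_const_mul' _ _ h.lt_one.ne_top]
        gcongr
      _ = ρ ^ (n + 1) * ∫⁻ ξ, V (F ξ x - x) ∂law := by ring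

/-- A drift inequality towards `x₀` bounds the backward iterates started at `x₀` uniformly in the
number of steps. -/
theorem lintegral_backwardIter_sub_const (h : ContractsOnAverage F law V c ρ) {x₀ : E}
    {b B : ℝ≥0∞} (hdrift : ∀ x, ∫⁻ ξ, V (F ξ x - x₀) ∂law ≤ ρ * V (x - x₀) + b)
    (hB : ρ * B + b ≤ B) (n : ℕ) :
    ∫⁻ ω, V (backwardIter F n ω x₀ - x₀) ∂(Measure.infinitePi fun _ => law) ≤ B := by
  induction n with
  | zero =>
    have : V 0 = 0 := by simpa using h.upper 0
    simp [backwardIter, this]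
  | succ n ih =>
    rw [lintegral_infinitePi_consSeq law (g := fun ω => V (backwardIter F (n + 1) ω x₀ - x₀))
      (h.measurable_gauge_backwardIter_sub (n + 1) 0 x₀ x₀)]
    calc _ ≤ ∫⁻ ω, ρ * V (backwardIter F n ω x₀ - x₀) + b
          ∂(Measure.infinitePi fun _ => law) := lintegral_mono fun ω => hdrift _
      _ ≤ ρ * B + b := by
        rw [lintegral_add_right _ measurable_const, lintegral_const_mul' _ _ h.lt_one.ne_top]
        simp only [lintegral_const, measure_univ, mul_one]
        gcongr
      _ ≤ B := hB

/-- Backward iterates from two starting points merge almost surely. -/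
theorem ae_tendsto_backwardIter_sub (h : ContractsOnAverage F law V c ρ) (x y : E) :
    ∀ᵐ ω ∂(Measure.infinitePi fun _ => law),
      Tendsto (fun n => backwardIter F n ω x - backwardIter F n ω y) atTop (𝓝 0) := by
  have hm : ∀ n, Measurable fun ω => V (backwardIter F n ω x - backwardIter F n ω y) := fun n =>
    h.measurable_gauge_backwardIter_sub n n x y
  have hsum : ∫⁻ ω, ∑' n, V (backwardIter F n ω x - backwardIter F n ω y)
      ∂(Measure.infinitePi fun _ => law) ≠ ∞ := by
    rw [lintegral_tsum fun n => (hm n).aemeasurable]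
    refine ne_top_of_le_ne_top ?_ (ENNReal.tsum_le_tsum fun n =>
      h.lintegral_backwardIter_sub n x y)
    rw [ENNReal.tsum_mul_right, ENNReal.tsum_geometric]
    exact ENNReal.mul_ne_top (ENNReal.inv_ne_top.2 (tsub_pos_of_lt h.lt_one).ne')
      (h.gauge_ne_top _)
  filter_upwards [ae_lt_top' (AEMeasurable.tsum fun n => (hm n).aemeasurable) hsum]
    with ω hω
  have h0 := ENNReal.tendsto_atTop_zero_of_tsum_ne_top hω.ne
  have h1 : Tendsto (fun n => ‖backwardIter F n ω x - backwardIter F n ω y‖ₑ ^ 2)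
      atTop (𝓝 0) := by
    have h2 := ENNReal.Tendsto.const_mul h0 (Or.inr (ENNReal.inv_ne_top.2 h.ne_zero))
    rw [mul_zero] at h2
    exact tendsto_of_tendsto_of_tendsto_of_le_of_le tendsto_const_nhds h2
      (fun _ => zero_le) fun n => h.enorm_sq_le _
  have h2 := h1.ennrpow_const (1 / 2)
  rw [tendsto_zero_iff_enorm_tendsto_zero]
  have hsqrt : ∀ a : ℝ≥0∞, (a ^ 2) ^ (1 / 2 : ℝ) = a := fun a => by
    rw [← ENNReal.rpow_natCast, ← ENNReal.rpow_mul]; norm_num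
  simpa only [hsqrt, ENNReal.zero_rpow_of_pos (one_half_pos (α := ℝ))] using h2

/-- Backward iterates converge almost surely: the consecutive distances have summable
expectations. -/
theorem exists_limit_backwardIter [CompleteSpace E] (h : ContractsOnAverage F law V c ρ) {x : E}
    (hx : ∫⁻ ξ, V (F ξ x - x) ∂law ≠ ∞) :
    ∃ Y : (ℕ → N) → E, Measurable Y ∧ ∀ᵐ ω ∂(Measure.infinitePi fun _ => law),
      Tendsto (fun n => backwardIter F n ω x) atTop (𝓝 (Y ω)) := by
  refine measurable_limit_of_tendsto_metrizable_ae
    (fun n => (h.measurable_backwardIter_apply n x).aemeasurable) ?_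
  obtain ⟨θ, hθ0, hθ1, hθ⟩ : ∃ θ : ℝ≥0∞, θ ≠ 0 ∧ θ < 1 ∧ ρ ≤ θ * θ := by
    have h1 : ρ ^ (1 / 2 : ℝ) < 1 := ENNReal.rpow_lt_one h.lt_one (by norm_num)
    refine ⟨max 2⁻¹ (ρ ^ (1 / 2 : ℝ)), ?_, ?_, ?_⟩
    · exact (lt_of_lt_of_le (by simp) (le_max_left _ _)).ne'
    · exact max_lt (by simp) h1
    · calc ρ = ρ ^ (1 / 2 : ℝ) * ρ ^ (1 / 2 : ℝ) := by
            rw [← ENNReal.rpow_add_of_nonneg _ _ (by norm_num) (by norm_num)]; norm_num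
        _ ≤ _ := mul_le_mul' (le_max_right _ _) (le_max_right _ _)
  have hθt : θ ≠ ∞ := hθ1.ne_top
  set d : ℕ → (ℕ → N) → ℝ≥0∞ := fun n ω =>
    θ ^ n + (θ ^ n)⁻¹ * (c⁻¹ * V (backwardIter F (n + 1) ω x - backwardIter F n ω x)) with hd
  have hVm : ∀ n, Measurable fun ω => V (backwardIter F (n + 1) ω x - backwardIter F n ω x) :=
    fun n => h.measurable_gauge_backwardIter_sub (n + 1) n x x
  have hdm : ∀ n, Measurable (d n) := fun n =>
    measurable_const.add (((hVm n).const_mul _).const_mul _)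
  have hsum : ∫⁻ ω, ∑' n, d n ω ∂(Measure.infinitePi fun _ => law) ≠ ∞ := by
    rw [lintegral_tsum fun n => (hdm n).aemeasurable]
    refine ne_top_of_le_ne_top ?_ (ENNReal.tsum_le_tsum (g := fun n =>
      θ ^ n * (1 + c⁻¹ * ∫⁻ ξ, V (F ξ x - x) ∂law)) fun n => ?_)
    · rw [ENNReal.tsum_mul_right, ENNReal.tsum_geometric]
      exact ENNReal.mul_ne_top (ENNReal.inv_ne_top.2 (tsub_pos_of_lt hθ1).ne')
        (ENNReal.add_ne_top.2 ⟨ENNReal.one_ne_top,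
          ENNReal.mul_ne_top (ENNReal.inv_ne_top.2 h.ne_zero) hx⟩)
    · have hn0 : θ ^ n ≠ 0 := pow_ne_zero _ hθ0
      have hnt : θ ^ n ≠ ∞ := ENNReal.pow_ne_top hθt
      rw [hd, lintegral_add_left measurable_const, lintegral_const_mul _ ((hVm n).const_mul _),
        lintegral_const_mul _ (hVm n)]
      simp only [lintegral_const, measure_univ, mul_one]
      calc _ ≤ θ ^ n + (θ ^ n)⁻¹ *
            (c⁻¹ * ((θ * θ) ^ n * ∫⁻ ξ, V (F ξ x - x) ∂law)) := by
            gcongr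
            refine (h.lintegral_backwardIter_succ_sub n x).trans ?_
            gcongr
        _ = θ ^ n + ((θ ^ n)⁻¹ * θ ^ n) * (θ ^ n * (c⁻¹ * ∫⁻ ξ, V (F ξ x - x) ∂law)) := by
            rw [mul_pow]; ring
        _ = _ := by rw [ENNReal.inv_mul_cancel hn0 hnt]; ring
  filter_upwards [ae_lt_top' (AEMeasurable.tsum fun n => (hdm n).aemeasurable) hsum]
    with ω hω
  refine cauchySeq_tendsto_of_complete
    (cauchySeq_of_edist_le_of_tsum_ne_top (fun n => d n ω) (fun n => ?_) hω.ne)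
  -- `a ≤ θ ^ n + a ^ 2 / θ ^ n` turns a bound on second moments into one on first moments.
  rw [edist_comm, edist_eq_enorm_sub]
  have hn0 : θ ^ n ≠ 0 := pow_ne_zero _ hθ0
  have hnt : θ ^ n ≠ ∞ := ENNReal.pow_ne_top hθt
  set a := ‖backwardIter F (n + 1) ω x - backwardIter F n ω x‖ₑ with ha
  rcases le_total a (θ ^ n) with hle | hle
  · exact hle.trans le_self_add
  · refine le_trans ?_ le_add_self
    calc a = (θ ^ n)⁻¹ * (θ ^ n * a) := by
          rw [← mul_assoc, ENNReal.inv_mul_cancel hn0 hnt, one_mul]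
      _ ≤ (θ ^ n)⁻¹ * (a * a) := by gcongr
      _ ≤ _ := by
        refine mul_le_mul_right ?_ _
        exact (sq a).symm.le.trans <| h.enorm_sq_le _

/-- Existence, uniqueness and a second moment bound for the stationary law. The stationary law is
that of the almost sure limit `Y` of the backward iterates: `Y` satisfies
`Y (ξ, ω) = F ξ (Y ω)`, and any other stationary law is the law of backward iterates started from
it, which merge with those that converge to `Y`. -/
theorem exists_stationary [CompleteSpace E] (h : ContractsOnAverage F law V c ρ) {x₀ : E}
    {b B : ℝ≥0∞} (hdrift : ∀ x, ∫⁻ ξ, V (F ξ x - x₀) ∂law ≤ ρ * V (x - x₀) + b)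
    (hb : b ≠ ∞) (hB : ρ * B + b ≤ B) :
    ∃ μ : Measure E, IsProbabilityMeasure μ ∧ chainStep F law μ = μ ∧
      (∀ ν : Measure E, IsProbabilityMeasure ν → chainStep F law ν = ν → ν = μ) ∧
      ∫⁻ x, ‖x - x₀‖ₑ ^ 2 ∂μ ≤ c⁻¹ * B := by
  have hx : ∫⁻ ξ, V (F ξ x₀ - x₀) ∂law ≠ ∞ := by
    refine ne_top_of_le_ne_top ?_ (hdrift x₀)
    exact ENNReal.add_ne_top.2 ⟨ENNReal.mul_ne_top h.lt_one.ne_top (h.gauge_ne_top _), hb⟩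
  obtain ⟨Y, hYm, hY⟩ := h.exists_limit_backwardIter hx
  set P : Measure (ℕ → N) := Measure.infinitePi fun _ => law with hP
  have hprob : IsProbabilityMeasure (P.map Y) := Measure.isProbabilityMeasure_map hYm.aemeasurable
  have hFs : Measurable fun z : E × N => F z.2 z.1 := h.measurable_map.comp measurable_swap
  refine ⟨P.map Y, hprob, ?_, fun ν hν hνs => ?_, ?_⟩
  · have hmp := measurePreserving_consSeq law
    have hcons : ∀ᵐ p ∂(law.prod P), F p.1 (Y p.2) = Y (consSeq p.1 p.2) := by
      have h1 := hmp.quasiMeasurePreserving.ae hY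
      have h2 : ∀ᵐ p ∂(law.prod P), Tendsto (fun n => backwardIter F n p.2 x₀) atTop
          (𝓝 (Y p.2)) := Measure.quasiMeasurePreserving_snd.ae hY
      filter_upwards [h1, h2] with p hp1 hp2
      exact tendsto_nhds_unique (((h.continuous_map p.1).tendsto _).comp hp2)
        (hp1.comp (tendsto_add_atTop_nat 1))
    have hprod : (P.map Y).prod law = (law.prod P).map fun p => (Y p.2, p.1) := by
      have h1 := Measure.map_prod_map P law hYm measurable_id
      rw [Measure.map_id] at h1
      rw [h1, ← Measure.prod_swap,
        Measure.map_map (hYm.prodMap measurable_id) measurable_swap]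
      rfl
    have hpair : Measurable fun p : N × (ℕ → N) => (Y p.2, p.1) :=
      (hYm.comp measurable_snd).prodMk measurable_fst
    rw [chainStep, hprod, Measure.map_map hFs hpair]
    conv_rhs => rw [hP, ← hmp.map_eq, Measure.map_map hYm measurable_consSeq]
    exact Measure.map_congr hcons
  · have hm : ∀ n, Measurable fun p : E × (ℕ → N) => backwardIter F n p.2 p.1 := fun n =>
      (measurable_backwardIter h.measurable_map n).comp measurable_swap
    have hlim : ∀ᵐ p ∂(ν.prod P), Tendsto (fun n => backwardIter F n p.2 p.1) atTop
        (𝓝 (Y p.2)) := by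
      have hY2 : ∀ᵐ p ∂(ν.prod P), Tendsto (fun n => backwardIter F n p.2 x₀) atTop
          (𝓝 (Y p.2)) := Measure.quasiMeasurePreserving_snd.ae hY
      have hset : MeasurableSet {p : E × (ℕ → N) | Tendsto
          (fun n => backwardIter F n p.2 p.1 - backwardIter F n p.2 x₀) atTop (𝓝 0)} :=
        measurableSet_tendsto _ fun n => (hm n).sub
          ((h.measurable_backwardIter_apply n x₀).comp measurable_snd)
      have hsub : ∀ᵐ p ∂(ν.prod P), Tendsto
          (fun n => backwardIter F n p.2 p.1 - backwardIter F n p.2 x₀) atTop (𝓝 0) :=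
        (Measure.ae_prod_iff_ae_ae hset).2
          (Eventually.of_forall fun x => h.ae_tendsto_backwardIter_sub x x₀)
      filter_upwards [hsub, hY2] with p h1 h2
      simpa using h1.add h2
    refine ext_of_forall_integral_eq_of_IsFiniteMeasure fun g => ?_
    have hlaw : ∀ n, (ν.prod P).map (fun p => backwardIter F n p.2 p.1) = ν := fun n => by
      rw [map_backwardIter h.measurable_map, Function.iterate_fixed hνs]
    have hconst : ∀ n, ∫ p, g (backwardIter F n p.2 p.1) ∂(ν.prod P) = ∫ x, g x ∂ν := fun n => by
      conv_rhs => rw [← hlaw n]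
      rw [integral_map (hm n).aemeasurable g.continuous.aestronglyMeasurable]
    have hdom := tendsto_integral_of_dominated_convergence (μ := ν.prod P)
      (F := fun n p => g (backwardIter F n p.2 p.1)) (f := fun p => g (Y p.2)) (fun _ => ‖g‖)
      (fun n => (g.continuous.measurable.comp (hm n)).aestronglyMeasurable)
      (integrable_const _) (fun n => Eventually.of_forall fun p => g.norm_coe_le_norm _)
      (hlim.mono fun p hp => (g.continuous.tendsto _).comp hp)
    simp only [hconst] at hdom
    have h1 := tendsto_nhds_unique tendsto_const_nhds hdom
    have hsnd : (ν.prod P).map (fun p => Y p.2) = P.map Y := by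
      have : (ν.prod P).map Prod.snd = P := by simp [Measure.map_snd_prod]
      conv_rhs => rw [← this, Measure.map_map hYm measurable_snd]
      rfl
    rw [h1, ← hsnd, integral_map (by exact (hYm.comp measurable_snd).aemeasurable)
      g.continuous.aestronglyMeasurable]
  · have hmeas : Measurable fun x : E => ‖x - x₀‖ₑ ^ 2 := by fun_prop
    rw [lintegral_map hmeas hYm]
    calc ∫⁻ ω, ‖Y ω - x₀‖ₑ ^ 2 ∂P
        ≤ ∫⁻ ω, liminf (fun n => ‖backwardIter F n ω x₀ - x₀‖ₑ ^ 2) atTop ∂P := by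
          refine lintegral_mono_ae (hY.mono fun ω hω => ?_)
          have hc : Continuous fun x : E => ‖x - x₀‖ₑ ^ 2 := by fun_prop
          exact (((hc.tendsto _).comp hω).liminf_eq).ge
      _ ≤ liminf (fun n => ∫⁻ ω, ‖backwardIter F n ω x₀ - x₀‖ₑ ^ 2 ∂P) atTop :=
          lintegral_liminf_le fun n => hmeas.comp (h.measurable_backwardIter_apply n x₀)
      _ ≤ c⁻¹ * B := by
          refine liminf_le_of_frequently_le' (Frequently.of_forall fun n => ?_)
          refine (lintegral_mono fun ω => h.enorm_sq_le _).trans ?_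
          rw [lintegral_const_mul' _ _ (ENNReal.inv_ne_top.2 h.ne_zero)]
          gcongr
          exact h.lintegral_backwardIter_sub_const hdrift hB n

/-- The `n`-step laws approach a stationary law at rate `ρ ^ n`, by the coupling that feeds the
same observations to both chains. -/
theorem W2_iterate_le (h : ContractsOnAverage F law V c ρ) {μ ν : Measure E}
    [IsProbabilityMeasure μ] [IsProbabilityMeasure ν] (hμ : chainStep F law μ = μ) (n : ℕ) :
    W2 ((chainStep F law)^[n] ν) μ ^ 2
      ≤ c⁻¹ * (∫⁻ z, ‖z.1 - z.2‖ₑ ^ 2 ∂(ν.prod μ)) * ρ ^ n := by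
  set P : Measure (ℕ → N) := Measure.infinitePi fun _ => law with hP
  set κ : (E × E) × (ℕ → N) → E × E := fun p =>
    (backwardIter F n p.2 p.1.1, backwardIter F n p.2 p.1.2) with hκ
  have hB := measurable_backwardIter h.measurable_map n
  have hκm : Measurable κ := by
    have h1 : Measurable fun p : (E × E) × (ℕ → N) => (p.2, p.1.1) := by fun_prop
    have h2 : Measurable fun p : (E × E) × (ℕ → N) => (p.2, p.1.2) := by fun_prop
    exact (hB.comp h1).prodMk (hB.comp h2)
  have hBs : Measurable fun p : E × (ℕ → N) => backwardIter F n p.2 p.1 := hB.comp measurable_swap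
  have hfst : (((ν.prod μ).prod P).map κ).map Prod.fst = (chainStep F law)^[n] ν := by
    rw [Measure.map_map measurable_fst hκm, ← map_backwardIter h.measurable_map law n ν]
    have h1 := Measure.map_prod_map (ν.prod μ) P measurable_fst measurable_id
    rw [Measure.map_fst_prod, measure_univ, one_smul, Measure.map_id] at h1
    rw [h1, Measure.map_map hBs (measurable_fst.prodMap measurable_id)]
    rfl
  have hsnd : (((ν.prod μ).prod P).map κ).map Prod.snd = μ := by
    rw [Measure.map_map measurable_snd hκm]
    conv_rhs => rw [← Function.iterate_fixed hμ n, ← map_backwardIter h.measurable_map law n μ]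
    have h1 := Measure.map_prod_map (ν.prod μ) P measurable_snd measurable_id
    rw [Measure.map_snd_prod, measure_univ, one_smul, Measure.map_id] at h1
    rw [h1, Measure.map_map hBs (measurable_snd.prodMap measurable_id)]
    rfl
  have hW : W2 ((chainStep F law)^[n] ν) μ
      ≤ (∫⁻ z, ‖z.1 - z.2‖ₑ ^ 2 ∂(((ν.prod μ).prod P).map κ)) ^ (1 / 2 : ℝ) :=
    iInf₂_le _ ⟨hfst, hsnd⟩
  have hm : Measurable fun z : E × E => ‖z.1 - z.2‖ₑ ^ 2 := by fun_prop
  calc W2 ((chainStep F law)^[n] ν) μ ^ 2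
      ≤ ((∫⁻ z, ‖z.1 - z.2‖ₑ ^ 2 ∂(((ν.prod μ).prod P).map κ)) ^ (1 / 2 : ℝ)) ^ 2 := by gcongr
    _ = ∫⁻ z, ‖z.1 - z.2‖ₑ ^ 2 ∂(((ν.prod μ).prod P).map κ) := by
        rw [← ENNReal.rpow_natCast, ← ENNReal.rpow_mul]; norm_num
    _ = ∫⁻ z, ∫⁻ ω, ‖backwardIter F n ω z.1 - backwardIter F n ω z.2‖ₑ ^ 2 ∂P ∂(ν.prod μ) := by
        rw [lintegral_map hm hκm, lintegral_prod _ (by exact (hm.comp hκm).aemeasurable)]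
    _ ≤ ∫⁻ z, c⁻¹ * (ρ ^ n * ‖z.1 - z.2‖ₑ ^ 2) ∂(ν.prod μ) := by
        refine lintegral_mono fun z => ?_
        refine (lintegral_mono fun ω => h.enorm_sq_le _).trans ?_
        rw [lintegral_const_mul' _ _ (ENNReal.inv_ne_top.2 h.ne_zero)]
        gcongr
        refine (h.lintegral_backwardIter_sub n z.1 z.2).trans ?_
        gcongr
        exact h.upper _
    _ = _ := by
        rw [lintegral_const_mul' _ _ (ENNReal.inv_ne_top.2 h.ne_zero),
          lintegral_const_mul' _ _ (ENNReal.pow_ne_top h.lt_one.ne_top)]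
        ring

end ContractsOnAverage

end Contraction

/-! ### Laws of trajectories -/

section Trajectories

theorem forwardIter_succ {N E : Type*} (F : N → E → E) (n : ℕ) (ω : ℕ → N) (z : E) :
    forwardIter F (n + 1) ω z = F (ω n) (forwardIter F n ω z) := by
  induction n generalizing ω z with
  | zero => rfl
  | succ n ih => exact ih (fun k => ω (k + 1)) (F (ω 0) z)

variable {S A : Type*} [Fintype A] [Nonempty A]

theorem continuous_maxQ (s : S) : Continuous fun q : S × A → ℝ => maxQ q s :=
  Continuous.finset_sup'_apply _ fun a _ => continuous_apply (s, a)

variable [Fintype S]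

theorem continuous_qUpdate (γ α : ℝ) (ξ : Noise S A) : Continuous (qUpdate γ α ξ) := by
  have h := fun s : S => (continuous_maxQ (A := A) s)
  unfold qUpdate
  fun_prop

theorem measurable_qUpdate (γ α : ℝ) :
    Measurable (Function.uncurry fun (ξ : Noise S A) q => qUpdate γ α ξ q) := by
  have h := fun s : S => (continuous_maxQ (A := A) s).measurable
  refine measurable_pi_lambda _ fun i => ?_
  simp only [Function.uncurry, qUpdate]
  fun_prop

/-- Along a trajectory the law evolves by the Markov chain: the initial value and the observations
jointly have a product law, and `q t` is their forward iteration. -/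
theorem IsTrajectory.map_eq {γ α : ℝ} {law : Measure (Noise S A)} {Ω : Type*}
    [MeasurableSpace Ω] {Pr : Measure Ω} [IsProbabilityMeasure Pr] [IsProbabilityMeasure law]
    {ξ : ℕ → Ω → Noise S A} {q : ℕ → Ω → S × A → ℝ} (h : IsTrajectory γ α law Pr ξ q) (t : ℕ) :
    Pr.map (q t) = (chainStep (qUpdate γ α) law)^[t] (Pr.map (q 0)) := by
  have hq : ∀ ω, q t ω = forwardIter (qUpdate γ α) t (fun k => ξ k ω) (q 0 ω) := by
    intro ω
    induction t with
    | zero => rfl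
    | succ t ih => rw [h.step, forwardIter_succ, ← ih]
  have hξm : Measurable fun ω k => ξ k ω := measurable_pi_lambda _ h.measurable_noise
  have hξ : Pr.map (fun ω k => ξ k ω) = Measure.infinitePi fun _ => law := by
    rw [h.indep_noise.map_fun_eq_infinitePi_map h.measurable_noise]
    simp_rw [h.law_noise]
  have : IsProbabilityMeasure (Pr.map (q 0)) :=
    Measure.isProbabilityMeasure_map h.measurable_init.aemeasurable
  have hpair := (indepFun_iff_map_prod_eq_prod_map_map h.measurable_init.aemeasurable
    hξm.aemeasurable).1 h.indep_init
  rw [hξ] at hpair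
  rw [← map_forwardIter (measurable_qUpdate γ α), ← hpair,
    Measure.map_map
      (by exact (measurable_forwardIter (measurable_qUpdate γ α) t).comp measurable_swap)
      (h.measurable_init.prodMk hξm)]
  congr 1
  exact funext hq

end Trajectories

/-! ### A smooth substitute for the squared sup norm -/

section Envelope

variable {ι : Type*} [Fintype ι]

/-- The Moreau envelope of the squared sup norm: its infimal convolution with `l` times the
squared Euclidean norm. -/
def supEnvelope (l : ℝ) (x : ι → ℝ) : ℝ≥0∞ :=
  ⨅ u : ι → ℝ, ENNReal.ofReal (‖u‖ ^ 2 + l * ∑ i, (x i - u i) ^ 2)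

theorem measurable_supEnvelope (l : ℝ) : Measurable (supEnvelope l : (ι → ℝ) → ℝ≥0∞) := by
  refine UpperSemicontinuous.measurable (upperSemicontinuous_iInf fun u => ?_)
  exact (ENNReal.continuous_ofReal.comp (by fun_prop)).upperSemicontinuous

theorem enorm_sq_eq_ofReal {E : Type*} [SeminormedAddCommGroup E] (x : E) :
    ‖x‖ₑ ^ 2 = ENNReal.ofReal (‖x‖ ^ 2) := by
  rw [ENNReal.ofReal_pow (norm_nonneg x), ofReal_norm]

theorem supEnvelope_le_enorm_sq (l : ℝ) (x : ι → ℝ) : supEnvelope l x ≤ ‖x‖ₑ ^ 2 := by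
  refine (iInf_le _ x).trans ?_
  rw [enorm_sq_eq_ofReal]
  simp

theorem norm_sq_le_sum_sq (x : ι → ℝ) : ‖x‖ ^ 2 ≤ ∑ i, x i ^ 2 := by
  rw [← Real.le_sqrt (norm_nonneg x) (Finset.sum_nonneg fun i _ => sq_nonneg _)]
  refine (pi_norm_le_iff_of_nonneg (Real.sqrt_nonneg _)).2 fun i => ?_
  refine Real.le_sqrt_of_sq_le ?_
  rw [Real.norm_eq_abs, sq_abs]
  exact Finset.single_le_sum (f := fun i => x i ^ 2) (fun i _ => sq_nonneg _) (Finset.mem_univ i)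

/-- With the weight `g / (1 - g)` the envelope is at least `g` times the squared sup norm. -/
theorem mul_norm_sq_le {g : ℝ} (hg0 : 0 < g) (hg1 : g < 1) (x u : ι → ℝ) :
    g * ‖x‖ ^ 2 ≤ ‖u‖ ^ 2 + g / (1 - g) * ∑ i, (x i - u i) ^ 2 := by
  have h1 : ‖x‖ ≤ ‖u‖ + ‖x - u‖ := by simpa using norm_add_le u (x - u)
  have h2 : ‖x - u‖ ^ 2 ≤ ∑ i, (x i - u i) ^ 2 := norm_sq_le_sum_sq (x - u)
  have hg : 0 < 1 - g := by linarith
  have h3 : ‖x‖ ^ 2 ≤ (‖u‖ + ‖x - u‖) ^ 2 := by gcongr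
  have h4 : g * (‖u‖ + ‖x - u‖) ^ 2 ≤ ‖u‖ ^ 2 + g / (1 - g) * ‖x - u‖ ^ 2 := by
    have : ‖u‖ ^ 2 + g / (1 - g) * ‖x - u‖ ^ 2 - g * (‖u‖ + ‖x - u‖) ^ 2
        = ((1 - g) * ‖u‖ - g * ‖x - u‖) ^ 2 / (1 - g) := by
      field_simp
      ring
    have h5 : 0 ≤ ((1 - g) * ‖u‖ - g * ‖x - u‖) ^ 2 / (1 - g) := by positivity
    linarith
  calc g * ‖x‖ ^ 2 ≤ g * (‖u‖ + ‖x - u‖) ^ 2 := by gcongr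
    _ ≤ ‖u‖ ^ 2 + g / (1 - g) * ‖x - u‖ ^ 2 := h4
    _ ≤ _ := by gcongr

theorem mul_enorm_sq_le_supEnvelope {g : ℝ} (hg0 : 0 < g) (hg1 : g < 1) (x : ι → ℝ) :
    ENNReal.ofReal g * ‖x‖ₑ ^ 2 ≤ supEnvelope (g / (1 - g)) x := by
  refine le_iInf fun u => ?_
  rw [enorm_sq_eq_ofReal, ← ENNReal.ofReal_mul hg0.le]
  exact ENNReal.ofReal_le_ofReal (mul_norm_sq_le hg0 hg1 x u)

/-- One step of stochastic approximation contracts the envelope. If the mean increment maps the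
displacement `x` to a vector `x + E[w]` of sup norm at most `g ‖x‖`, then `x + α w` splits as
`((1 - α) u + α (x + E[w])) + ((1 - α) (x - u) + α (w - E[w]))` for every `u`. The first summand is
nonrandom, and the second has a Euclidean norm to which the noise contributes only to order
`α ^ 2`. -/
theorem lintegral_supEnvelope_le {Ω : Type*} [MeasurableSpace Ω] {P : Measure Ω}
    [IsProbabilityMeasure P] {g α K b : ℝ} (hg0 : 0 < g) (hg1 : g < 1) (hα0 : 0 ≤ α) (hα1 : α ≤ 1)
    (hK : 0 ≤ K) (hb : 0 ≤ b) {w : Ω → ι → ℝ} (hw : ∀ i, MemLp (fun ω => w ω i) 2 P) (x : ι → ℝ)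
    (hmean : ∀ i, |x i + ∫ ω, w ω i ∂P| ≤ g * ‖x‖)
    (hvar : ∑ i, ∫ ω, w ω i ^ 2 ∂P ≤ K * ‖x‖ ^ 2 + b) :
    ∫⁻ ω, supEnvelope (g / (1 - g)) (fun i => x i + α * w ω i) ∂P
      ≤ ENNReal.ofReal (1 - α * (1 - g) + α ^ 2 * (g / (1 - g) * K / g))
          * supEnvelope (g / (1 - g)) x + ENNReal.ofReal (α ^ 2 * (g / (1 - g) * b)) := by
  set l := g / (1 - g) with hl
  have hg' : 0 < 1 - g := by linarith
  have hl0 : 0 < l := div_pos hg0 hg'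
  set r := 1 - α * (1 - g) + α ^ 2 * (l * K / g) with hr
  have hr0 : 0 ≤ r := by
    have : α * (1 - g) ≤ 1 := by nlinarith
    have : 0 ≤ α ^ 2 * (l * K / g) := by positivity
    linarith
  conv_rhs => rw [supEnvelope, ENNReal.mul_iInf fun h => absurd h ENNReal.ofReal_ne_top,
    ENNReal.iInf_add]
  refine le_iInf fun u => ?_
  rw [← ENNReal.ofReal_mul hr0, ← ENNReal.ofReal_add (by positivity) (by positivity)]
  set v : ι → ℝ := fun i => (1 - α) * u i + α * (x i + ∫ ω, w ω i ∂P) with hv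
  have hwi : ∀ i, Integrable (fun ω => w ω i) P := fun i => (hw i).integrable one_le_two
  have hwsq : ∀ i, Integrable (fun ω => w ω i ^ 2) P := fun i => (hw i).integrable_sq
  have hsplit : ∀ i, ∀ ω, (x i + α * w ω i - v i) ^ 2
      = ((1 - α) * (x i - u i) - α * ∫ ω, w ω i ∂P) ^ 2
        + 2 * ((1 - α) * (x i - u i) - α * ∫ ω, w ω i ∂P) * α * w ω i + α ^ 2 * w ω i ^ 2 := by
    intro i ω
    simp only [hv]
    ring
  have hint : ∀ i, Integrable (fun ω => (x i + α * w ω i - v i) ^ 2) P := fun i => by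
    simp_rw [hsplit i]
    exact ((integrable_const _).add ((hwi i).const_mul _)).add ((hwsq i).const_mul _)
  have hcoord : ∀ i, ∫ ω, (x i + α * w ω i - v i) ^ 2 ∂P
      ≤ (1 - α) * (x i - u i) ^ 2 + α ^ 2 * ∫ ω, w ω i ^ 2 ∂P := by
    intro i
    simp_rw [hsplit i]
    rw [integral_add (by exact (integrable_const _).add ((hwi i).const_mul _))
        ((hwsq i).const_mul _),
      integral_add (integrable_const _) ((hwi i).const_mul _), integral_const_mul,
      integral_const_mul]
    simp only [integral_const, probReal_univ, one_smul]
    have h1 : 0 ≤ α * (1 - α) * (x i - u i) ^ 2 :=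
      mul_nonneg (mul_nonneg hα0 (by linarith)) (sq_nonneg _)
    have h2 : 0 ≤ (α * ∫ ω, w ω i ∂P) ^ 2 := sq_nonneg _
    linarith [show ((1 - α) * (x i - u i) - α * ∫ ω, w ω i ∂P) ^ 2
        + 2 * ((1 - α) * (x i - u i) - α * ∫ ω, w ω i ∂P) * α * ∫ ω, w ω i ∂P
        = (1 - α) * (x i - u i) ^ 2 - α * (1 - α) * (x i - u i) ^ 2
          - (α * ∫ ω, w ω i ∂P) ^ 2 by ring]
  have hvnorm : ‖v‖ ^ 2 ≤ (1 - α) * ‖u‖ ^ 2 + α * (g * ‖x‖) ^ 2 := by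
    have h1 : ‖v‖ ≤ (1 - α) * ‖u‖ + α * (g * ‖x‖) := by
      have hα' : 0 ≤ 1 - α := by linarith
      refine (pi_norm_le_iff_of_nonneg (by positivity)).2 fun i => ?_
      calc ‖v i‖ ≤ |(1 - α) * u i| + |α * (x i + ∫ ω, w ω i ∂P)| := abs_add_le _ _
        _ = (1 - α) * ‖u i‖ + α * |x i + ∫ ω, w ω i ∂P| := by
          rw [abs_mul, abs_mul, abs_of_nonneg hα', abs_of_nonneg hα0, Real.norm_eq_abs]
        _ ≤ _ := by
          gcongr
          · exact norm_le_pi_norm u i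
          · exact hmean i
    have h2 : ‖v‖ ^ 2 ≤ ((1 - α) * ‖u‖ + α * (g * ‖x‖)) ^ 2 := by gcongr
    have h3 : 0 ≤ α * (1 - α) * (‖u‖ - g * ‖x‖) ^ 2 :=
      mul_nonneg (mul_nonneg hα0 (by linarith)) (sq_nonneg _)
    linarith [show (1 - α) * ‖u‖ ^ 2 + α * (g * ‖x‖) ^ 2
      - ((1 - α) * ‖u‖ + α * (g * ‖x‖)) ^ 2 = α * (1 - α) * (‖u‖ - g * ‖x‖) ^ 2 by ring]
  calc ∫⁻ ω, supEnvelope l (fun i => x i + α * w ω i) ∂P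
      ≤ ∫⁻ ω, ENNReal.ofReal (‖v‖ ^ 2 + l * ∑ i, (x i + α * w ω i - v i) ^ 2) ∂P :=
        lintegral_mono fun ω => iInf_le _ v
    _ = ENNReal.ofReal (∫ ω, (‖v‖ ^ 2 + l * ∑ i, (x i + α * w ω i - v i) ^ 2) ∂P) := by
        rw [ofReal_integral_eq_lintegral_ofReal]
        · exact (integrable_const _).add ((integrable_finsetSum _ fun i _ => hint i).const_mul l)
        · exact Eventually.of_forall fun ω => by positivity
    _ ≤ _ := by
        refine ENNReal.ofReal_le_ofReal ?_
        rw [integral_add (integrable_const _)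
          ((integrable_finsetSum _ fun i _ => hint i).const_mul l), integral_const_mul,
          integral_finsetSum _ fun i _ => hint i]
        simp only [integral_const, probReal_univ, one_smul]
        have hφ := mul_norm_sq_le hg0 hg1 x u
        rw [← hl] at hφ
        set φ := ‖u‖ ^ 2 + l * ∑ i, (x i - u i) ^ 2 with hφdef
        have h1 : ∑ i, ∫ ω, (x i + α * w ω i - v i) ^ 2 ∂P
            ≤ (1 - α) * ∑ i, (x i - u i) ^ 2 + α ^ 2 * (K * ‖x‖ ^ 2 + b) := by
          refine (Finset.sum_le_sum fun i _ => hcoord i).trans ?_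
          rw [Finset.sum_add_distrib, ← Finset.mul_sum, ← Finset.mul_sum]
          gcongr
        have h2 : α * (g * ‖x‖) ^ 2 ≤ α * g * φ := by
          calc α * (g * ‖x‖) ^ 2 = α * g * (g * ‖x‖ ^ 2) := by ring
            _ ≤ α * g * φ := by gcongr
        have h3 : α ^ 2 * l * (K * ‖x‖ ^ 2) ≤ α ^ 2 * (l * K / g) * φ := by
          calc α ^ 2 * l * (K * ‖x‖ ^ 2) = α ^ 2 * (l * K / g) * (g * ‖x‖ ^ 2) := by
                field_simp
            _ ≤ _ := by gcongr
        have h4 : l * ∑ i, ∫ ω, (x i + α * w ω i - v i) ^ 2 ∂P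
            ≤ l * ((1 - α) * ∑ i, (x i - u i) ^ 2 + α ^ 2 * (K * ‖x‖ ^ 2 + b)) := by gcongr
        have h5 : r * φ = φ - α * φ + α * g * φ + α ^ 2 * (l * K / g) * φ := by rw [hr]; ring
        have h6 : α * φ = α * ‖u‖ ^ 2 + α * l * ∑ i, (x i - u i) ^ 2 := by rw [hφdef]; ring
        linarith

end Envelope

/-! ### The Bellman equation -/

section Bellman

variable {S A : Type*} [Fintype A]

theorem le_maxQ [Nonempty A] (q : S × A → ℝ) (s : S) (a : A) : q (s, a) ≤ maxQ q s :=
  Finset.le_sup' (fun a => q (s, a)) (Finset.mem_univ a)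

variable [Fintype S]

theorem abs_maxQ_sub_le [Nonempty A] (p q : S × A → ℝ) (s : S) :
    |maxQ p s - maxQ q s| ≤ ‖p - q‖ := by
  have key : ∀ p q : S × A → ℝ, maxQ p s ≤ maxQ q s + ‖p - q‖ := fun p q => by
    refine Finset.sup'_le _ _ fun a _ => ?_
    have h1 := (le_abs_self _).trans (norm_le_pi_norm (p - q) (s, a))
    have h2 := le_maxQ q s a
    simp only [Pi.sub_apply] at h1
    linarith
  rw [abs_sub_le_iff]
  have h1 := key p q
  have h2 := key q p
  rw [norm_sub_rev] at h2
  constructor <;> linarith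

theorem MDP.abs_sum_trans_mul_le (M : MDP S A) (x : S × A) {f : S → ℝ} {b : ℝ}
    (hf : ∀ s, |f s| ≤ b) : |∑ s, M.trans x s * f s| ≤ b := by
  calc |∑ s, M.trans x s * f s| ≤ ∑ s, |M.trans x s * f s| := Finset.abs_sum_le_sum_abs _ _
    _ ≤ ∑ s, M.trans x s * b := Finset.sum_le_sum fun s _ => by
        have h0 : 0 ≤ M.trans x s := (M.trans x).2.1 s
        rw [abs_mul, abs_of_nonneg h0]
        exact mul_le_mul_of_nonneg_left (hf s) h0
    _ = b := by
        have h1 : ∑ s, M.trans x s = 1 := (M.trans x).2.2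
        rw [← Finset.sum_mul, h1, one_mul]

/-- The Bellman optimality operator `q ↦ γ P f(q) + r̄`. -/
def MDP.bellman [Nonempty A] (M : MDP S A) (q : S × A → ℝ) (x : S × A) : ℝ :=
  M.discount * ∑ s, M.trans x s * maxQ q s + M.meanReward x

theorem MDP.exists_bellman_eq [Nonempty A] (M : MDP S A) : ∃ q, M.bellman q = q := by
  have hc : ContractingWith ⟨M.discount, M.discount_pos.le⟩ (M.bellman) := by
    refine ⟨M.discount_lt_one, LipschitzWith.of_dist_le_mul fun p q => ?_⟩
    rw [dist_eq_norm, dist_eq_norm]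
    refine (pi_norm_le_iff_of_nonneg (mul_nonneg M.discount_pos.le (norm_nonneg _))).2 fun x => ?_
    have h1 : (M.bellman p - M.bellman q) x
        = M.discount * ∑ s, M.trans x s * (maxQ p s - maxQ q s) := by
      simp only [Pi.sub_apply, MDP.bellman, mul_sub, Finset.sum_sub_distrib]
      ring
    rw [h1, Real.norm_eq_abs, abs_mul, abs_of_nonneg M.discount_pos.le]
    exact mul_le_mul_of_nonneg_left (M.abs_sum_trans_mul_le x (abs_maxQ_sub_le p q))
      M.discount_pos.le
  exact ⟨_, hc.fixedPoint_isFixedPt⟩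

/-- The transition probabilities of the state-action chain under the policy `π`. -/
def MDP.policyTrans (M : MDP S A) (π : S → stdSimplex ℝ A) (x y : S × A) : ℝ :=
  M.trans x y.1 * π y.1 y.2

theorem MDP.policyTrans_nonneg (M : MDP S A) (π : S → stdSimplex ℝ A) (x y : S × A) :
    0 ≤ M.policyTrans π x y :=
  mul_nonneg ((M.trans x).2.1 y.1) ((π y.1).2.1 y.2)

theorem MDP.sum_policyTrans_mul (M : MDP S A) (π : S → stdSimplex ℝ A) (x : S × A)
    (f : S × A → ℝ) :
    ∑ y, M.policyTrans π x y * f y = ∑ s, M.trans x s * ∑ a, π s a * f (s, a) := by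
  simp only [MDP.policyTrans, Fintype.sum_prod_type, Finset.mul_sum, mul_assoc]

theorem MDP.sum_policyTrans (M : MDP S A) (π : S → stdSimplex ℝ A) (x : S × A) :
    ∑ y, M.policyTrans π x y = 1 := by
  have h := M.sum_policyTrans_mul π x fun _ => 1
  have h1 : ∀ s, ∑ a, π s a = 1 := fun s => (π s).2.2
  have h2 : ∑ s, M.trans x s = 1 := (M.trans x).2.2
  simpa [h1, h2] using h

/-- A maximum principle: `d ≤ γ P_π d` forces `d ≤ 0`. -/
theorem MDP.nonpos_of_le_discount_mul [Nonempty S] [Nonempty A] (M : MDP S A)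
    (π : S → stdSimplex ℝ A) {d : S × A → ℝ}
    (hd : ∀ x, d x ≤ M.discount * ∑ y, M.policyTrans π x y * d y) (x : S × A) : d x ≤ 0 := by
  obtain ⟨m, hm⟩ := Finite.exists_max d
  have h1 : ∑ y, M.policyTrans π m y * d y ≤ d m := by
    calc _ ≤ ∑ y, M.policyTrans π m y * d m := Finset.sum_le_sum fun y _ =>
          mul_le_mul_of_nonneg_left (hm y) (M.policyTrans_nonneg π m y)
      _ = d m := by rw [← Finset.sum_mul, M.sum_policyTrans, one_mul]
  have h2 := (hd m).trans (mul_le_mul_of_nonneg_left h1 M.discount_pos.le)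
  have h3 : d m ≤ 0 := by
    have := M.discount_lt_one
    by_contra h
    nlinarith
  exact (hm x).trans h3

section Policy

variable [DecidableEq S] [DecidableEq A]

/-- First-step decomposition of the expected reward after `k + 1` steps. -/
theorem MDP.sum_stepProb_succ_mul (M : MDP S A) (π : S → stdSimplex ℝ A) (x : S × A) (k : ℕ)
    (f : S × A → ℝ) :
    ∑ y, M.stepProb π x (k + 1) y * f y
      = ∑ z, M.policyTrans π x z * ∑ y, M.stepProb π z k y * f y := by
  induction k generalizing f with
  | zero => simp [MDP.stepProb, MDP.policyTrans]
  | succ k ih =>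
    have hstep : ∀ (z : S × A) (k : ℕ), ∑ y, M.stepProb π z (k + 1) y * f y
        = ∑ y, M.stepProb π z k y * ∑ w, M.policyTrans π y w * f w := fun z k => by
      simp only [MDP.stepProb, Finset.sum_mul, Finset.mul_sum, MDP.policyTrans]
      rw [Finset.sum_comm]
      exact Finset.sum_congr rfl fun _ _ => Finset.sum_congr rfl fun _ _ => by ring
    rw [hstep x (k + 1), ih]
    simp_rw [hstep _ k]

theorem MDP.abs_sum_stepProb_mul_le (M : MDP S A) (π : S → stdSimplex ℝ A) (x : S × A) (k : ℕ)
    (f : S × A → ℝ) : |∑ y, M.stepProb π x k y * f y| ≤ ‖f‖ := by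
  induction k generalizing x with
  | zero =>
    simp only [MDP.stepProb, ite_mul, one_mul, zero_mul, Finset.sum_ite_eq', Finset.mem_univ,
      if_true]
    exact norm_le_pi_norm f x
  | succ k ih =>
    rw [M.sum_stepProb_succ_mul]
    calc _ ≤ ∑ z, |M.policyTrans π x z * ∑ y, M.stepProb π z k y * f y| :=
          Finset.abs_sum_le_sum_abs _ _
      _ ≤ ∑ z, M.policyTrans π x z * ‖f‖ := Finset.sum_le_sum fun z _ => by
          rw [abs_mul, abs_of_nonneg (M.policyTrans_nonneg π x z)]
          exact mul_le_mul_of_nonneg_left (ih z) (M.policyTrans_nonneg π x z)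
      _ = ‖f‖ := by rw [← Finset.sum_mul, M.sum_policyTrans, one_mul]

theorem MDP.summable_qPolicy (M : MDP S A) (π : S → stdSimplex ℝ A) (x : S × A) :
    Summable fun k : ℕ => M.discount ^ k * ∑ y, M.stepProb π x k y * M.meanReward y := by
  refine Summable.of_norm_bounded
    ((summable_geometric_of_lt_one M.discount_pos.le M.discount_lt_one).mul_right
      ‖M.meanReward‖) fun k => ?_
  rw [norm_mul, Real.norm_of_nonneg (pow_nonneg M.discount_pos.le k)]
  exact mul_le_mul_of_nonneg_left (M.abs_sum_stepProb_mul_le π x k _)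
    (pow_nonneg M.discount_pos.le k)

/-- The Bellman equation of a policy. -/
theorem MDP.qPolicy_eq (M : MDP S A) (π : S → stdSimplex ℝ A) (x : S × A) :
    M.qPolicy π x
      = M.discount * ∑ y, M.policyTrans π x y * M.qPolicy π y + M.meanReward x := by
  have h0 : ∑ y, M.stepProb π x 0 y * M.meanReward y = M.meanReward x := by
    simp [MDP.stepProb]
  rw [MDP.qPolicy, (M.summable_qPolicy π x).tsum_eq_zero_add, pow_zero, one_mul, h0, add_comm]
  congr 1
  have h1 : ∀ k : ℕ, M.discount ^ (k + 1) * ∑ y, M.stepProb π x (k + 1) y * M.meanReward y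
      = ∑ z, M.discount * (M.policyTrans π x z *
        (M.discount ^ k * ∑ y, M.stepProb π z k y * M.meanReward y)) := fun k => by
    rw [M.sum_stepProb_succ_mul, Finset.mul_sum]
    exact Finset.sum_congr rfl fun z _ => by ring
  simp_rw [h1]
  rw [Summable.tsum_finsetSum fun z _ => ((M.summable_qPolicy π z).mul_left _).mul_left _,
    Finset.mul_sum]
  refine Finset.sum_congr rfl fun z _ => ?_
  rw [tsum_mul_left, tsum_mul_left, MDP.qPolicy]

theorem MDP.qPolicy_le [Nonempty S] [Nonempty A] (M : MDP S A) (π : S → stdSimplex ℝ A)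
    {q : S × A → ℝ} (hq : M.bellman q = q) (x : S × A) : M.qPolicy π x ≤ q x := by
  refine sub_nonpos.1 (M.nonpos_of_le_discount_mul π (d := fun x => M.qPolicy π x - q x)
    (fun x => ?_) x)
  have h1 : ∑ y, M.policyTrans π x y * q y ≤ ∑ s, M.trans x s * maxQ q s := by
    rw [M.sum_policyTrans_mul]
    refine Finset.sum_le_sum fun s _ => mul_le_mul_of_nonneg_left ?_ ((M.trans x).2.1 s)
    calc ∑ a, π s a * q (s, a) ≤ ∑ a, π s a * maxQ q s := Finset.sum_le_sum fun a _ =>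
          mul_le_mul_of_nonneg_left (le_maxQ q s a) ((π s).2.1 a)
      _ = maxQ q s := by
          have h : ∑ a, π s a = 1 := (π s).2.2
          rw [← Finset.sum_mul, h, one_mul]
  have h2 : q x = M.discount * ∑ s, M.trans x s * maxQ q s + M.meanReward x :=
    (congrFun hq x).symm
  simp only [mul_sub, Finset.sum_sub_distrib]
  rw [M.qPolicy_eq π x]
  have h3 := mul_le_mul_of_nonneg_left h1 M.discount_pos.le
  linarith

theorem MDP.exists_le_qPolicy [Nonempty S] [Nonempty A] (M : MDP S A) {q : S × A → ℝ}
    (hq : M.bellman q = q) : ∃ π : S → stdSimplex ℝ A, ∀ x, q x ≤ M.qPolicy π x := by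
  have hmax : ∀ s, ∃ a, maxQ q s = q (s, a) := fun s => by
    obtain ⟨a, -, ha⟩ := Finset.exists_mem_eq_sup' (Finset.univ_nonempty (α := A))
      fun a => q (s, a)
    exact ⟨a, ha⟩
  choose a ha using hmax
  -- The greedy policy plays `a s`, a maximizer of `q (s, ·)`, with probability one.
  let π : S → stdSimplex ℝ A := fun s => ⟨Pi.single (a s) 1, single_mem_stdSimplex ℝ (a s)⟩
  refine ⟨π, fun x => sub_nonpos.1 (M.nonpos_of_le_discount_mul π
    (d := fun x => q x - M.qPolicy π x) (fun x => le_of_eq ?_) x)⟩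
  have h1 : ∑ y, M.policyTrans π x y * q y = ∑ s, M.trans x s * maxQ q s := by
    rw [M.sum_policyTrans_mul]
    refine Finset.sum_congr rfl fun s _ => ?_
    have : ∀ b, π s b = (Pi.single (a s) 1 : A → ℝ) b := fun _ => rfl
    simp [this, ha, Pi.single_apply]
  have h2 : q x = M.discount * ∑ s, M.trans x s * maxQ q s + M.meanReward x :=
    (congrFun hq x).symm
  simp only [mul_sub, Finset.sum_sub_distrib]
  rw [M.qPolicy_eq π x, h1]
  linarith

/-- The Bellman optimality equation: the supremum over policies is the fixed point of the
contraction `MDP.bellman`, attained by a policy that is greedy for it. -/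
theorem MDP.bellman_qStar [Nonempty S] [Nonempty A] (M : MDP S A) :
    M.bellman M.qStar = M.qStar := by
  obtain ⟨q, hq⟩ := M.exists_bellman_eq
  obtain ⟨π, hπ⟩ := M.exists_le_qPolicy hq
  have : M.qStar = q := funext fun x => by
    have : Nonempty (S → stdSimplex ℝ A) := ⟨π⟩
    exact le_antisymm (ciSup_le fun π' => M.qPolicy_le π' hq x)
      ((hπ x).trans (le_ciSup (f := fun π => M.qPolicy π x)
        ⟨q x, by rintro _ ⟨π', rfl⟩; exact M.qPolicy_le π' hq x⟩ π))
  rw [this, hq]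

end Policy

end Bellman

/-! ### Moments of the update direction -/

section Increment

variable {S A : Type*} [Fintype S] [Fintype A]

/-- The random update direction `D (γ P f(q) - q + r)`. -/
def increment [Nonempty A] (γ : ℝ) (ξ : Noise S A) (q : S × A → ℝ) (i : S × A) : ℝ :=
  ∑ j, ξ.1 i j * (γ * (∑ s, ξ.2.1 j s * maxQ q s) - q j + ξ.2.2 j)

theorem qUpdate_apply [Nonempty A] (γ α : ℝ) (ξ : Noise S A) (q : S × A → ℝ) (i : S × A) :
    qUpdate γ α ξ q i = q i + α * increment γ ξ q i := rfl

/-- The update direction in terms of `D`, `D P` and `D r`, the variables with finite moments. -/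
theorem increment_eq [Nonempty A] (γ : ℝ) (ξ : Noise S A) (q : S × A → ℝ) (i : S × A) :
    increment γ ξ q i = ∑ s, (γ * maxQ q s) * ∑ j, ξ.1 i j * ξ.2.1 j s
      - ∑ j, q j * ξ.1 i j + ∑ j, ξ.1 i j * ξ.2.2 j := by
  simp only [increment, mul_add, mul_sub, Finset.sum_add_distrib, Finset.sum_sub_distrib,
    Finset.mul_sum]
  rw [Finset.sum_comm]
  congr 2
  · exact Finset.sum_congr rfl fun _ _ => Finset.sum_congr rfl fun _ _ => by ring
  · exact Finset.sum_congr rfl fun _ _ => by ring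

/-- The row sum `∑ₛ |(D P)_{is}| + ∑ⱼ |D_{ij}| + |(D r)_i|`, which bounds the update direction. -/
def noiseSize (ξ : Noise S A) (i : S × A) : ℝ :=
  ∑ s, |∑ j, ξ.1 i j * ξ.2.1 j s| + ∑ j, |ξ.1 i j| + |∑ j, ξ.1 i j * ξ.2.2 j|

theorem abs_increment_sub_le [Nonempty A] {γ : ℝ} (hγ0 : 0 ≤ γ) (hγ1 : γ ≤ 1) (ξ : Noise S A)
    (p q : S × A → ℝ) (i : S × A) :
    |increment γ ξ q i - increment γ ξ p i| ≤ noiseSize ξ i * ‖q - p‖ := by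
  have h : increment γ ξ q i - increment γ ξ p i
      = ∑ s, (γ * (maxQ q s - maxQ p s)) * (∑ j, ξ.1 i j * ξ.2.1 j s)
        - ∑ j, (q j - p j) * ξ.1 i j := by
    simp only [increment_eq, mul_sub, sub_mul, Finset.sum_sub_distrib]
    ring
  rw [h]
  calc _ ≤ |∑ s, (γ * (maxQ q s - maxQ p s)) * (∑ j, ξ.1 i j * ξ.2.1 j s)|
        + |∑ j, (q j - p j) * ξ.1 i j| := abs_sub _ _
    _ ≤ ∑ s, ‖q - p‖ * |∑ j, ξ.1 i j * ξ.2.1 j s| + ∑ j, ‖q - p‖ * |ξ.1 i j| := by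
        refine add_le_add ((Finset.abs_sum_le_sum_abs _ _).trans
          (Finset.sum_le_sum fun s _ => ?_)) ((Finset.abs_sum_le_sum_abs _ _).trans
          (Finset.sum_le_sum fun j _ => ?_))
        · rw [abs_mul, abs_mul, abs_of_nonneg hγ0]
          gcongr
          calc γ * |maxQ q s - maxQ p s| ≤ 1 * ‖q - p‖ :=
                mul_le_mul hγ1 (abs_maxQ_sub_le q p s) (abs_nonneg _) zero_le_one
            _ = _ := one_mul _
        · rw [abs_mul]
          gcongr
          exact norm_le_pi_norm (q - p) j
    _ ≤ _ := by
        rw [← Finset.mul_sum, ← Finset.mul_sum, noiseSize]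
        have : 0 ≤ |∑ j, ξ.1 i j * ξ.2.2 j| * ‖q - p‖ := by positivity
        linarith

theorem abs_increment_le [Nonempty A] {γ : ℝ} (hγ0 : 0 ≤ γ) (hγ1 : γ ≤ 1) (ξ : Noise S A)
    (q : S × A → ℝ) (i : S × A) : |increment γ ξ q i| ≤ noiseSize ξ i * (‖q‖ + 1) := by
  have h0 : increment γ ξ 0 i = ∑ j, ξ.1 i j * ξ.2.2 j := by
    have : ∀ s, maxQ (0 : S × A → ℝ) s = 0 := fun s => by simp [maxQ]
    simp [increment, this]
  have h1 := abs_increment_sub_le hγ0 hγ1 ξ 0 q i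
  rw [sub_zero] at h1
  have h2 : |increment γ ξ 0 i| ≤ noiseSize ξ i := by
    rw [h0, noiseSize]
    have : 0 ≤ ∑ s, |∑ j, ξ.1 i j * ξ.2.1 j s| + ∑ j, |ξ.1 i j| := by positivity
    linarith
  have h3 := abs_add_le (increment γ ξ q i - increment γ ξ 0 i) (increment γ ξ 0 i)
  rw [sub_add_cancel] at h3
  linarith

variable {M : MDP S A} {law : Measure (Noise S A)}

theorem memLp_increment [Nonempty A] {p : ℝ≥0∞} (hmom : HasFiniteMoments p law) (γ : ℝ)
    (q : S × A → ℝ) (i : S × A) : MemLp (fun ξ => increment γ ξ q i) p law := by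
  simp_rw [increment_eq]
  exact ((memLp_finsetSum _ fun s _ => (hmom.moment_DP i s).const_mul _).sub
    (memLp_finsetSum _ fun j _ => (hmom.moment_D i j).const_mul _)).add (hmom.moment_Dr i)

theorem memLp_noiseSize {p : ℝ≥0∞} (hmom : HasFiniteMoments p law) (i : S × A) :
    MemLp (fun ξ => noiseSize ξ i) p law := by
  unfold noiseSize
  exact ((memLp_finsetSum _ fun s _ => (hmom.moment_DP i s).abs).add
    (memLp_finsetSum _ fun j _ => (hmom.moment_D i j).abs)).add (hmom.moment_Dr i).abs

/-- The sum of the second moments of the entries of `noiseSize`. -/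
def noiseMoment (law : Measure (Noise S A)) : ℝ := ∑ i, ∫ ξ, noiseSize ξ i ^ 2 ∂law

theorem noiseMoment_nonneg (law : Measure (Noise S A)) : 0 ≤ noiseMoment law :=
  Finset.sum_nonneg fun _ _ => integral_nonneg fun _ => sq_nonneg _

/-- A pointwise bound by a multiple of `noiseSize` gives a bound on second moments. -/
theorem sum_integral_sq_le (hmom : HasFiniteMoments 2 law) {w : Noise S A → S × A → ℝ}
    (hw : ∀ i, MemLp (fun ξ => w ξ i) 2 law) {b : ℝ}
    (h : ∀ ξ i, |w ξ i| ≤ noiseSize ξ i * b) :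
    ∑ i, ∫ ξ, w ξ i ^ 2 ∂law ≤ noiseMoment law * b ^ 2 := by
  rw [noiseMoment, Finset.sum_mul]
  refine Finset.sum_le_sum fun i _ => ?_
  rw [← integral_mul_const]
  refine integral_mono (hw i).integrable_sq ((memLp_noiseSize hmom i).integrable_sq.mul_const _)
    fun ξ => ?_
  simp only
  rw [← mul_pow, ← sq_abs]
  exact pow_le_pow_left₀ (abs_nonneg _) (h ξ i) 2

theorem integral_increment [Nonempty A] (hlaw : IsAdmissible M law)
    (hmom : HasFiniteMoments 2 law) (q : S × A → ℝ) (i : S × A) :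
    ∫ ξ, increment M.discount ξ q i ∂law = meanD law i * (M.bellman q i - q i) := by
  have := hlaw.isProbabilityMeasure
  have hDP := fun s => ((hmom.moment_DP i s).integrable one_le_two).const_mul
    (M.discount * maxQ q s)
  have hD := fun j => ((hmom.moment_D i j).integrable one_le_two).const_mul (q j)
  have hDr := (hmom.moment_Dr i).integrable one_le_two
  have h1 : ∑ j, q j * ∫ ξ, ξ.1 i j ∂law = q i * meanD law i := by
    refine Finset.sum_eq_single i (fun j _ hj => ?_) (by simp)
    rw [hlaw.meanD_offDiag i j hj.symm, mul_zero]
  simp_rw [increment_eq]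
  have hsub : Integrable (fun ξ : Noise S A => ∑ s, M.discount * maxQ q s *
      ∑ j, ξ.1 i j * ξ.2.1 j s - ∑ j, q j * ξ.1 i j) law :=
    (integrable_finsetSum _ fun s _ => hDP s).sub (integrable_finsetSum _ fun j _ => hD j)
  rw [integral_add hsub hDr,
    integral_sub (integrable_finsetSum _ fun s _ => hDP s)
      (integrable_finsetSum _ fun j _ => hD j),
    integral_finsetSum _ fun s _ => hDP s, integral_finsetSum _ fun j _ => hD j]
  simp_rw [integral_const_mul, hlaw.mean_DP]
  rw [h1, hlaw.mean_Dr, MDP.bellman]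
  have h2 : ∑ s, M.discount * maxQ q s * (meanD law i * M.trans i s)
      = meanD law i * (M.discount * ∑ s, M.trans i s * maxQ q s) := by
    simp only [Finset.mul_sum]
    exact Finset.sum_congr rfl fun _ _ => by ring
  rw [h2]
  ring

variable [Nonempty S] [Nonempty A]

theorem gammaZero_pos (hlaw : IsAdmissible M law) : 0 < gammaZero M law := by
  obtain ⟨i⟩ : Nonempty (S × A) := inferInstance
  have h1 : Finset.univ.inf' Finset.univ_nonempty (meanD law) ≤ 1 :=
    (Finset.inf'_le _ (Finset.mem_univ i)).trans (hlaw.meanD_mem i).2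
  have h2 := M.discount_pos
  have h3 := M.discount_lt_one
  rw [gammaZero]
  nlinarith

theorem gammaZero_lt_one (hlaw : IsAdmissible M law) : gammaZero M law < 1 := by
  have h1 : 0 < Finset.univ.inf' Finset.univ_nonempty (meanD law) :=
    (Finset.lt_inf'_iff _).2 fun i _ => (hlaw.meanD_mem i).1
  have h3 := M.discount_lt_one
  rw [gammaZero]
  nlinarith

/-- The expected update with stepsize one contracts the sup norm by `γ₀`. -/
theorem abs_mean_update_sub_le (hlaw : IsAdmissible M law) (p q : S × A → ℝ) (i : S × A) :
    |q i - p i + meanD law i * ((M.bellman q i - q i) - (M.bellman p i - p i))|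
      ≤ gammaZero M law * ‖q - p‖ := by
  obtain ⟨hD0, hD1⟩ := hlaw.meanD_mem i
  have hD : 0 ≤ 1 - meanD law i := by linarith
  have hγ := M.discount_pos
  have hγ1 := M.discount_lt_one
  have h1 : q i - p i + meanD law i * ((M.bellman q i - q i) - (M.bellman p i - p i))
      = (1 - meanD law i) * (q i - p i) + meanD law i * (M.discount *
        ∑ s, M.trans i s * (maxQ q s - maxQ p s)) := by
    simp only [MDP.bellman, mul_sub, Finset.sum_sub_distrib]
    ring
  have h2 : |q i - p i| ≤ ‖q - p‖ := norm_le_pi_norm (q - p) i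
  have h3 := M.abs_sum_trans_mul_le i (abs_maxQ_sub_le q p)
  have h4 : Finset.univ.inf' Finset.univ_nonempty (meanD law) ≤ meanD law i :=
    Finset.inf'_le _ (Finset.mem_univ i)
  rw [h1]
  calc _ ≤ |(1 - meanD law i) * (q i - p i)| + |meanD law i * (M.discount *
        ∑ s, M.trans i s * (maxQ q s - maxQ p s))| := abs_add_le _ _
    _ ≤ (1 - meanD law i) * ‖q - p‖ + meanD law i * (M.discount * ‖q - p‖) := by
        rw [abs_mul, abs_mul, abs_mul, abs_of_nonneg hD, abs_of_pos hD0, abs_of_pos hγ]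
        gcongr
    _ = (1 - (1 - M.discount) * meanD law i) * ‖q - p‖ := by ring
    _ ≤ _ := by
        rw [gammaZero]
        gcongr

end Increment

/-! ### Contraction and drift of the recursion -/

section Recursion

variable {S A : Type*} [Fintype S] [Fintype A] [Nonempty S] [Nonempty A] {M : MDP S A}
  {law : Measure (Noise S A)}

/-- The second-order coefficient in the one-step contraction of the envelope. -/
def secondOrderCoeff (M : MDP S A) (law : Measure (Noise S A)) : ℝ :=
  gammaZero M law / (1 - gammaZero M law) * (2 * noiseMoment law) / gammaZero M law

/-- The stepsizes for which the second-order terms are absorbed by the difference between the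
rates `1 - √γ₀` and `1 - γ₀`. -/
def maxStepsize (M : MDP S A) (law : Measure (Noise S A)) : ℝ :=
  min 1 ((√(gammaZero M law) - gammaZero M law) / (secondOrderCoeff M law + 1))

theorem gammaZero_lt_sqrt (hlaw : IsAdmissible M law) :
    gammaZero M law < √(gammaZero M law) := by
  have h0 := gammaZero_pos hlaw
  have h1 := gammaZero_lt_one hlaw
  exact Real.lt_sqrt_of_sq_lt (by nlinarith)

theorem sqrt_gammaZero_lt_one (hlaw : IsAdmissible M law) : √(gammaZero M law) < 1 := by
  rw [Real.sqrt_lt' one_pos, one_pow]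
  exact gammaZero_lt_one hlaw

theorem secondOrderCoeff_nonneg (hlaw : IsAdmissible M law) : 0 ≤ secondOrderCoeff M law := by
  have h0 := gammaZero_pos hlaw
  have h1 : 0 < 1 - gammaZero M law := by linarith [gammaZero_lt_one hlaw]
  have h2 := noiseMoment_nonneg law
  unfold secondOrderCoeff
  positivity

theorem maxStepsize_pos (hlaw : IsAdmissible M law) : 0 < maxStepsize M law := by
  have h0 := secondOrderCoeff_nonneg hlaw
  have h1 := gammaZero_lt_sqrt hlaw
  exact lt_min one_pos (div_pos (by linarith) (by linarith))

theorem contraction_factor_le (hlaw : IsAdmissible M law) {α : ℝ}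
    (hα : α ∈ Ioc 0 (maxStepsize M law)) :
    1 - α * (1 - gammaZero M law) + α ^ 2 * secondOrderCoeff M law
      ≤ 1 - α * (1 - √(gammaZero M law)) := by
  have h0 := secondOrderCoeff_nonneg hlaw
  have h1 : α * (secondOrderCoeff M law + 1) ≤ √(gammaZero M law) - gammaZero M law :=
    (le_div_iff₀ (by linarith)).1 (hα.2.trans (min_le_right _ _))
  have h2 := hα.1
  nlinarith

theorem contractsOnAverage_qUpdate (hlaw : IsAdmissible M law) (hmom : HasFiniteMoments 2 law)
    {α : ℝ} (hα : α ∈ Ioc 0 (maxStepsize M law)) :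
    ContractsOnAverage (qUpdate M.discount α) law
      (supEnvelope (gammaZero M law / (1 - gammaZero M law))) (ENNReal.ofReal (gammaZero M law))
      (ENNReal.ofReal (1 - α * (1 - √(gammaZero M law)))) where
  measurable_map := measurable_qUpdate _ _
  continuous_map ξ := continuous_qUpdate _ _ ξ
  measurable_gauge := measurable_supEnvelope _
  ne_zero := by simpa using gammaZero_pos hlaw
  ne_top := ENNReal.ofReal_ne_top
  lt_one := by
    rw [ENNReal.ofReal_lt_one]
    have := mul_pos hα.1 (sub_pos.2 (sqrt_gammaZero_lt_one hlaw))
    linarith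
  lower x := mul_enorm_sq_le_supEnvelope (gammaZero_pos hlaw) (gammaZero_lt_one hlaw) x
  upper x := supEnvelope_le_enorm_sq _ x
  contract p q := by
    have := hlaw.isProbabilityMeasure
    have hmem := fun q i => memLp_increment hmom M.discount q i
    have hκ := noiseMoment_nonneg law
    have h := lintegral_supEnvelope_le (P := law) (K := 2 * noiseMoment law) (b := 0)
      (w := fun ξ i => increment M.discount ξ p i - increment M.discount ξ q i)
      (gammaZero_pos hlaw) (gammaZero_lt_one hlaw) hα.1.le (hα.2.trans (min_le_left _ _))
      (by positivity) le_rfl (fun i => (hmem p i).sub (hmem q i)) (p - q) (fun i => by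
        rw [integral_sub ((hmem p i).integrable one_le_two) ((hmem q i).integrable one_le_two),
          integral_increment hlaw hmom, integral_increment hlaw hmom, ← mul_sub]
        exact abs_mean_update_sub_le hlaw q p i)
      ((sum_integral_sq_le hmom (fun i => (hmem p i).sub (hmem q i)) fun ξ i =>
        abs_increment_sub_le M.discount_pos.le M.discount_lt_one.le ξ q p i).trans (by
          nlinarith [mul_nonneg hκ (sq_nonneg ‖p - q‖)]))
    simp only [mul_zero, ENNReal.ofReal_zero, add_zero] at h
    refine (le_of_eq (lintegral_congr fun ξ => congrArg _ (funext fun i => ?_))).trans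
      (h.trans ?_)
    · simp only [Pi.sub_apply, qUpdate_apply]
      ring
    · gcongr
      exact contraction_factor_le hlaw hα

/-- The constant term in the drift inequality of the recursion towards the optimal Q-function. -/
def driftCoeff [DecidableEq S] [DecidableEq A] (M : MDP S A) (law : Measure (Noise S A)) : ℝ :=
  gammaZero M law / (1 - gammaZero M law) * (2 * noiseMoment law * (‖M.qStar‖ + 1) ^ 2)

theorem driftCoeff_nonneg [DecidableEq S] [DecidableEq A] (hlaw : IsAdmissible M law) :
    0 ≤ driftCoeff M law := by
  have h0 := gammaZero_pos hlaw
  have h1 : 0 < 1 - gammaZero M law := by linarith [gammaZero_lt_one hlaw]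
  have h2 := noiseMoment_nonneg law
  unfold driftCoeff
  positivity

theorem lintegral_supEnvelope_qUpdate_sub_qStar_le [DecidableEq S] [DecidableEq A]
    (hlaw : IsAdmissible M law) (hmom : HasFiniteMoments 2 law) {α : ℝ}
    (hα : α ∈ Ioc 0 (maxStepsize M law)) (q : S × A → ℝ) :
    ∫⁻ ξ, supEnvelope (gammaZero M law / (1 - gammaZero M law))
        (qUpdate M.discount α ξ q - M.qStar) ∂law
      ≤ ENNReal.ofReal (1 - α * (1 - √(gammaZero M law)))
          * supEnvelope (gammaZero M law / (1 - gammaZero M law)) (q - M.qStar)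
        + ENNReal.ofReal (α ^ 2 * driftCoeff M law) := by
  have := hlaw.isProbabilityMeasure
  have hmem := fun i => memLp_increment hmom M.discount q i
  have hκ := noiseMoment_nonneg law
  have hnorm : (‖q‖ + 1) ^ 2 ≤ 2 * ‖q - M.qStar‖ ^ 2 + 2 * (‖M.qStar‖ + 1) ^ 2 := by
    have h1 : ‖q‖ ≤ ‖q - M.qStar‖ + ‖M.qStar‖ := by
      simpa using norm_add_le (q - M.qStar) M.qStar
    have h2 : (‖q‖ + 1) ^ 2 ≤ (‖q - M.qStar‖ + (‖M.qStar‖ + 1)) ^ 2 :=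
      pow_le_pow_left₀ (by positivity) (by linarith) 2
    nlinarith [sq_nonneg (‖q - M.qStar‖ - (‖M.qStar‖ + 1))]
  have h := lintegral_supEnvelope_le (P := law) (K := 2 * noiseMoment law)
    (b := 2 * noiseMoment law * (‖M.qStar‖ + 1) ^ 2)
    (w := fun ξ i => increment M.discount ξ q i)
    (gammaZero_pos hlaw) (gammaZero_lt_one hlaw) hα.1.le (hα.2.trans (min_le_left _ _))
    (by positivity) (by positivity) hmem (q - M.qStar) (fun i => by
      rw [integral_increment hlaw hmom]
      have h1 := abs_mean_update_sub_le hlaw M.qStar q i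
      rwa [M.bellman_qStar, sub_self, sub_zero] at h1)
    ((sum_integral_sq_le hmom hmem fun ξ i =>
      abs_increment_le M.discount_pos.le M.discount_lt_one.le ξ q i).trans (by
        have := mul_le_mul_of_nonneg_left hnorm hκ
        linarith))
  refine (le_of_eq (lintegral_congr fun ξ => congrArg _ (funext fun i => ?_))).trans
    (h.trans ?_)
  · simp only [Pi.sub_apply, qUpdate_apply]
    ring
  · refine add_le_add ?_ le_rfl
    gcongr
    exact contraction_factor_le hlaw hα

/-- The stationary law of the recursion, with its second moment about the optimal Q-function. -/
theorem exists_stationary_qUpdate {S A : Type*} [Fintype S] [Fintype A] [DecidableEq S]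
    [DecidableEq A] [Nonempty S] [Nonempty A] {M : MDP S A} {law : Measure (Noise S A)}
    (hlaw : IsAdmissible M law) (hmom : HasFiniteMoments 2 law) {α : ℝ}
    (hα : α ∈ Ioc 0 (maxStepsize M law)) :
    ∃ μ : Measure (S × A → ℝ), IsProbabilityMeasure μ ∧ IsStationary M.discount α law μ ∧
      (∀ ν : Measure (S × A → ℝ), IsProbabilityMeasure ν →
        IsStationary M.discount α law ν → ν = μ) ∧
      ∫⁻ x, ‖x - M.qStar‖ₑ ^ 2 ∂μ ≤ (ENNReal.ofReal (gammaZero M law))⁻¹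
        * ENNReal.ofReal (driftCoeff M law / (1 - √(gammaZero M law))) * ENNReal.ofReal α := by
  have := hlaw.isProbabilityMeasure
  have hg : 0 < 1 - √(gammaZero M law) := sub_pos.2 (sqrt_gammaZero_lt_one hlaw)
  have hd := driftCoeff_nonneg hlaw
  have hα0 := hα.1
  have hρ : 0 ≤ 1 - α * (1 - √(gammaZero M law)) := by
    have h1 : α ≤ 1 := hα.2.trans (min_le_left _ _)
    have h2 : 0 ≤ √(gammaZero M law) := Real.sqrt_nonneg _
    nlinarith
  -- `B = α d / (1 - √γ₀)` solves `ρ B + α ^ 2 d = B` for `ρ = 1 - α (1 - √γ₀)`.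
  obtain ⟨μ, h1, h2, h3, h4⟩ := (contractsOnAverage_qUpdate hlaw hmom hα).exists_stationary
    (B := ENNReal.ofReal (driftCoeff M law / (1 - √(gammaZero M law)) * α))
    (lintegral_supEnvelope_qUpdate_sub_qStar_le hlaw hmom hα) ENNReal.ofReal_ne_top (by
      rw [← ENNReal.ofReal_mul hρ, ← ENNReal.ofReal_add (by positivity) (by positivity)]
      refine ENNReal.ofReal_le_ofReal (le_of_eq ?_)
      field_simp
      ring)
  refine ⟨μ, h1, h2, h3, h4.trans_eq ?_⟩
  rw [ENNReal.ofReal_mul (by positivity), mul_assoc]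

end Recursion

end QLearning

end

theorem mainTheorem6 {S A : Type*} [Fintype S] [Fintype A] [DecidableEq S] [DecidableEq A]
    [Nonempty S] [Nonempty A] (M : QLearning.MDP S A) (law : Measure (QLearning.Noise S A))
    (hlaw : QLearning.IsAdmissible M law) (hmom : QLearning.HasFiniteMoments 2 law) :
    ∃ αbar : ℝ, 0 < αbar ∧ αbar ≤ 1 ∧ ∃ μ : ℝ → Measure (S × A → ℝ),
      -- existence and uniqueness of the stationary distribution, the law of `q^(α)`
      (∀ α ∈ Ioc 0 αbar,
        IsProbabilityMeasure (μ α) ∧ QLearning.IsStationary M.discount α law (μ α) ∧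
        ∀ ν : Measure (S × A → ℝ), IsProbabilityMeasure ν →
          QLearning.IsStationary M.discount α law ν → ν = μ α) ∧
      -- geometric convergence; the constant depends on the initial law only through a bound on
      -- its second moment
      (∀ R : ℝ≥0, ∃ c : ℝ≥0, ∀ α ∈ Ioc 0 αbar,
        ∀ (Ω : Type*) [MeasurableSpace Ω] (Pr : Measure Ω) [IsProbabilityMeasure Pr]
          (ξ : ℕ → Ω → QLearning.Noise S A) (q : ℕ → Ω → S × A → ℝ),
          QLearning.IsTrajectory M.discount α law Pr ξ q →
          ∫⁻ ω, ‖q 0 ω‖ₑ ^ 2 ∂Pr ≤ R →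
          ∀ t : ℕ, QLearning.W2 (Pr.map (q t)) (μ α) ^ 2 ≤
            c * ENNReal.ofReal (1 - α * (1 - √(QLearning.gammaZero M law))) ^ t) ∧
      -- the second moment of `q^(α) - q*` is of order `α`
      ∃ C : ℝ≥0, ∀ α ∈ Ioc 0 αbar,
        ∫⁻ x, ENNReal.ofReal (∑ i, (x i - M.qStar i) ^ 2) ∂(μ α) ≤ C * ENNReal.ofReal α := by
  have := hlaw.isProbabilityMeasure
  choose! μ hprob hstat huniq hmoment using
    fun α (hα : α ∈ Ioc 0 (QLearning.maxStepsize M law)) =>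
      QLearning.exists_stationary_qUpdate hlaw hmom hα
  have hg0 : (ENNReal.ofReal (QLearning.gammaZero M law))⁻¹ ≠ ∞ := by
    simpa using QLearning.gammaZero_pos hlaw
  set C₁ : ℝ≥0∞ := (ENNReal.ofReal (QLearning.gammaZero M law))⁻¹ * ENNReal.ofReal
    (QLearning.driftCoeff M law / (1 - √(QLearning.gammaZero M law))) with hC₁
  have hC₁top : C₁ ≠ ∞ := ENNReal.mul_ne_top hg0 ENNReal.ofReal_ne_top
  refine ⟨QLearning.maxStepsize M law, QLearning.maxStepsize_pos hlaw, min_le_left _ _, μ,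
    fun α hα => ⟨hprob α hα, hstat α hα, huniq α hα⟩, fun R => ?_, ?_⟩
  · set c : ℝ≥0∞ := (ENNReal.ofReal (QLearning.gammaZero M law))⁻¹
      * (3 * R + 3 * C₁ + 3 * ‖M.qStar‖ₑ ^ 2) with hc
    have hctop : c ≠ ∞ := by
      refine ENNReal.mul_ne_top hg0 ?_
      have h3 : (3 : ℝ≥0∞) ≠ ∞ := by norm_num
      exact ENNReal.add_ne_top.2 ⟨ENNReal.add_ne_top.2
        ⟨ENNReal.mul_ne_top h3 ENNReal.coe_ne_top, ENNReal.mul_ne_top h3 hC₁top⟩,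
        ENNReal.mul_ne_top h3 (ENNReal.pow_ne_top enorm_ne_top)⟩
    refine ⟨c.toNNReal, fun α hα Ω _ Pr _ ξ q hq hR t => ?_⟩
    rw [ENNReal.coe_toNNReal hctop, hq.map_eq]
    have := hprob α hα
    have hν : IsProbabilityMeasure (Pr.map (q 0)) :=
      Measure.isProbabilityMeasure_map hq.measurable_init.aemeasurable
    refine ((QLearning.contractsOnAverage_qUpdate hlaw hmom hα).W2_iterate_le
      (hstat α hα) t).trans ?_
    rw [hc]
    gcongr
    have hν2 : ∫⁻ x, ‖x‖ₑ ^ 2 ∂(Pr.map (q 0)) ≤ R := by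
      rwa [lintegral_map (by fun_prop) hq.measurable_init]
    have hμ2 : ∫⁻ x, ‖x - M.qStar‖ₑ ^ 2 ∂(μ α) ≤ C₁ := by
      refine (hmoment α hα).trans ?_
      calc C₁ * ENNReal.ofReal α ≤ C₁ * 1 := by
            gcongr
            exact ENNReal.ofReal_le_one.2 (hα.2.trans (min_le_left _ _))
        _ = C₁ := mul_one _
    have hpt : ∀ x y : S × A → ℝ, ‖x - y‖ₑ ^ 2
        ≤ 3 * ‖x‖ₑ ^ 2 + 3 * ‖y - M.qStar‖ₑ ^ 2 + 3 * ‖M.qStar‖ₑ ^ 2 := fun x y => by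
      simp only [QLearning.enorm_sq_eq_ofReal]
      rw [show (3 : ℝ≥0∞) = ENNReal.ofReal 3 by norm_num, ← ENNReal.ofReal_mul (by norm_num),
        ← ENNReal.ofReal_mul (by norm_num), ← ENNReal.ofReal_mul (by norm_num),
        ← ENNReal.ofReal_add (by positivity) (by positivity),
        ← ENNReal.ofReal_add (by positivity) (by positivity)]
      refine ENNReal.ofReal_le_ofReal ?_
      have h1 : ‖x - y‖ ≤ ‖x‖ + ‖y - M.qStar‖ + ‖M.qStar‖ := by
        have h2 := norm_sub_le x y
        have h3 := norm_add_le (y - M.qStar) M.qStar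
        rw [sub_add_cancel] at h3
        linarith
      have h2 : ‖x - y‖ ^ 2 ≤ (‖x‖ + ‖y - M.qStar‖ + ‖M.qStar‖) ^ 2 := by gcongr
      nlinarith [sq_nonneg (‖x‖ - ‖y - M.qStar‖), sq_nonneg (‖x‖ - ‖M.qStar‖),
        sq_nonneg (‖y - M.qStar‖ - ‖M.qStar‖)]
    calc ∫⁻ z, ‖z.1 - z.2‖ₑ ^ 2 ∂((Pr.map (q 0)).prod (μ α))
        ≤ ∫⁻ z, (3 * ‖z.1‖ₑ ^ 2 + 3 * ‖z.2 - M.qStar‖ₑ ^ 2 + 3 * ‖M.qStar‖ₑ ^ 2)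
          ∂((Pr.map (q 0)).prod (μ α)) := lintegral_mono fun z => hpt z.1 z.2
      _ = 3 * ∫⁻ x, ‖x‖ₑ ^ 2 ∂(Pr.map (q 0)) + 3 * ∫⁻ x, ‖x - M.qStar‖ₑ ^ 2 ∂(μ α)
          + 3 * ‖M.qStar‖ₑ ^ 2 := by
        rw [lintegral_add_right _ measurable_const, lintegral_add_right _ (by fun_prop),
          lintegral_const_mul _ (by fun_prop), lintegral_const_mul _ (by fun_prop),
          measurePreserving_fst.lintegral_comp (f := fun x : S × A → ℝ => ‖x‖ₑ ^ 2)
            (by fun_prop),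
          measurePreserving_snd.lintegral_comp (f := fun x : S × A → ℝ => ‖x - M.qStar‖ₑ ^ 2)
            (by fun_prop)]
        simp
      _ ≤ _ := by gcongr
  · have hCtop : (Fintype.card (S × A) : ℝ≥0∞) * C₁ ≠ ∞ :=
      ENNReal.mul_ne_top (ENNReal.natCast_ne_top _) hC₁top
    refine ⟨((Fintype.card (S × A) : ℝ≥0∞) * C₁).toNNReal, fun α hα => ?_⟩
    rw [ENNReal.coe_toNNReal hCtop, mul_assoc]
    calc ∫⁻ x, ENNReal.ofReal (∑ i, (x i - M.qStar i) ^ 2) ∂(μ α)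
        ≤ ∫⁻ x, (Fintype.card (S × A) : ℝ≥0∞) * ‖x - M.qStar‖ₑ ^ 2 ∂(μ α) := by
          refine lintegral_mono fun x => ?_
          rw [QLearning.enorm_sq_eq_ofReal, ← ENNReal.ofReal_natCast,
            ← ENNReal.ofReal_mul (Nat.cast_nonneg _)]
          refine ENNReal.ofReal_le_ofReal ?_
          rw [← nsmul_eq_mul]
          refine Finset.sum_le_card_nsmul _ _ _ fun i _ => ?_
          rw [← sq_abs]
          exact pow_le_pow_left₀ (abs_nonneg _) (norm_le_pi_norm (x - M.qStar) i) 2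
      _ = Fintype.card (S × A) * ∫⁻ x, ‖x - M.qStar‖ₑ ^ 2 ∂(μ α) :=
          lintegral_const_mul' _ _ (ENNReal.natCast_ne_top _)
      _ ≤ _ := by
          gcongr
          exact hmoment α hα
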